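/- Write $\mathbf{Gpd}^{\mathbb Z_2}=[\mathbf B(\mathbb Z_2),\mathbf{Gpd}]$ for the category of groupoids equipped with an involution and equivariant functors; $\underline f$ denotes the functor underlying a morphism $f$. A functor $F\colon A\to B$ of groupoids is a fibration if for every object $a$ of $A$ and every morphism $\varphi$ of $B$ with domain $F(a)$ there is a morphism of $A$ with domain $a$ (a lift of $\varphi$ at $a$) that $F$ maps to $\varphi$; it is a discrete fibration if moreover such a lift is always unique. A morphism $f$ of $\mathbf{Gpd}^{\mathbb Z_2}$ is a (projective) fibration if $\underline f$ is a fibration. A type-theoretic fibration category is a category $\mathscr C$ with (1) a terminal object $1$; (2) a subcategory of fibrations containing all isomorphisms and all morphisms with codomain $1$ (a morphism is called an acyclic cofibration if it has the left lifting property with respect to all fibrations); such that (3) all pullbacks of fibrations exist and are fibrations; (4) for every fibration $g\colon A\to B$ the pullback functor $g^*\colon\mathscr C/B\to\mathscr C/A$ has a partial right adjoint $\Pi_g$, defined at all fibrations over $A$, whose values are fibrations over $B$; (5) every morphism factors as an acyclic cofibration followed by a fibration. A fibration $p\colon\widetilde U\to U$ in such a category is a universe if (i) pullbacks of $p$ are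 closed under composition and contain the identities; (ii) if $f\colon B\to A$ and $g\colon A\to C$ are pullbacks of $p$, so is $\Pi_g f$; (iii) if $A\to C$ and $B\to C$ are pullbacks of $p$, then any morphism $A\to B$ over $C$ factors as an acyclic cofibration followed by a pullback of $p$. The pullbacks of $p$ are called the small fibrations. Let $\kappa$ be an inaccessible cardinal. A discrete groupoid is $\kappa$-small if its set of objects has cardinality $<\kappa$. ($\mathbf{Gpd}$ consists of the groupoids that are small with respect to a Grothendieck universe containing as an element the universe $\mathcal V\ni\kappa$ from which the $\kappa$-small discrete groupoids in the next definition are taken.) Let $U$ be the groupoid whose objects are the triples $(A,B,\varphi)$ with $A,B$ $\kappa$-small discrete groupoids and $\varphi\colon A\to B$ an isomorphism, and whose morphisms $(A,B,\varphi)\to(C,D,\psi)$ are the pairs of isomorphisms $(\rho\colon A\to C,\tau\colon B\to D)$ with $\psi\circ\rho=\tau\circ\varphi$; its involution is $(A,B,\varphi)\mapsto(B,A,\varphi^{-1})$, $(\rho,\tau)\mapsto(\tau,\rho)$. Let $\widetilde U$ be the groupoid whose objects are the tuples $(A,B,\varphi,a)$ with $(A,B,\varphi)\in U$ and $a$ an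 object of $A$, and whose morphisms $(A,B,\varphi,a)\to(C,D,\psi,c)$ are the morphisms $(\rho,\tau)$ of $U$ with $\rho(a)=c$; its involution is $(A,B,\varphi,a)\mapsto(B,A,\varphi^{-1},\varphi(a))$, $(\rho,\tau)\mapsto(\tau,\rho)$. Let $p\colon\widetilde U\to U$ be the projection $(A,B,\varphi,a)\mapsto(A,B,\varphi)$, $(\rho,\tau)\mapsto(\rho,\tau)$. Theorem. The category $\mathbf{Gpd}^{\mathbb Z_2}$ with the projective fibrations is a type-theoretic fibration category, and $p\colon\widetilde U\to U$ is a universe in it. Moreover, a morphism $f$ of $\mathbf{Gpd}^{\mathbb Z_2}$ is a small fibration (a pullback of $p$) if and only if $\underline f$ is a discrete fibration all of whose fibres are $\kappa$-small. -/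

import Mathlib

open CategoryTheory CategoryTheory.Limits

universe v u w

/-! ## Type-theoretic fibration categories and universes in them -/

section FibrationCategory

variable {C : Type u} [Category.{v} C]

/-- `q : P ⟶ B` is a value `Π_g f` at `f : X ⟶ A` of the (partial) right adjoint of the pullback
functor `g^* : C/B ⥤ C/A`: morphisms `h ⟶ q` over `B` correspond, naturally in `h`, to morphisms
`g^* h ⟶ f` over `A`. -/
def IsDependentProduct {A B X P : C} (g : A ⟶ B) [HasPullbacksAlong g]
    (f : X ⟶ A) (q : P ⟶ B) : Prop :=
  Nonempty (((Over.pullback g).op ⋙ yoneda.obj (Over.mk f)).RepresentableBy (Over.mk q))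

/-- The category `C` together with the class `Fib` of fibrations is a type-theoretic fibration
category. The acyclic cofibrations are the morphisms in `Fib.llp`. -/
structure IsTypeTheoreticFibrationCategory (Fib : MorphismProperty C) : Prop where
  hasTerminal : HasTerminal C
  comp_mem : ∀ {X Y Z : C} (f : X ⟶ Y) (g : Y ⟶ Z), Fib f → Fib g → Fib (f ≫ g)
  of_isIso : ∀ {X Y : C} (f : X ⟶ Y), IsIso f → Fib f
  of_isTerminal : ∀ {X T : C} (f : X ⟶ T), Nonempty (IsTerminal T) → Fib f
  hasPullbacksAlong : ∀ {A B : C} (g : A ⟶ B), Fib g → HasPullbacksAlong g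
  of_isPullback : ∀ {A' A B' B : C} {t : A' ⟶ A} {g' : A' ⟶ B'} {g : A ⟶ B} {b : B' ⟶ B},
    IsPullback t g' g b → Fib g → Fib g'
  exists_dependentProduct : ∀ {A B X : C} (g : A ⟶ B) [HasPullbacksAlong g] (f : X ⟶ A),
    Fib g → Fib f → ∃ (P : C) (q : P ⟶ B), Fib q ∧ IsDependentProduct g f q
  exists_factorization : ∀ {X Y : C} (f : X ⟶ Y),
    ∃ (E : C) (i : X ⟶ E) (q : E ⟶ Y), Fib.llp i ∧ Fib q ∧ i ≫ q = f

/-- `f` is a pullback of `p`; when `p` is a universe, these are the `p`-small fibrations. -/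
def IsSmallFibration {E U : C} (p : E ⟶ U) {A B : C} (f : A ⟶ B) : Prop :=
  ∃ (t : A ⟶ E) (b : B ⟶ U), IsPullback t f p b

/-- The morphism `p` is a universe, with respect to the class `Fib` of fibrations (which is
supposed to make `C` a type-theoretic fibration category). -/
structure IsUniverse (Fib : MorphismProperty C) {E U : C} (p : E ⟶ U) : Prop where
  fib : Fib p
  id_small : ∀ X : C, IsSmallFibration p (𝟙 X)
  comp_small : ∀ {X Y Z : C} (f : X ⟶ Y) (g : Y ⟶ Z),
    IsSmallFibration p f → IsSmallFibration p g → IsSmallFibration p (f ≫ g)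
  dependentProduct_small : ∀ {X A B P : C} (f : X ⟶ A) (g : A ⟶ B) [HasPullbacksAlong g]
    (q : P ⟶ B), IsSmallFibration p f → IsSmallFibration p g → IsDependentProduct g f q →
      IsSmallFibration p q
  exists_factorization : ∀ {A B X : C} (a : A ⟶ X) (b : B ⟶ X) (f : A ⟶ B),
    IsSmallFibration p a → IsSmallFibration p b → f ≫ b = a →
      ∃ (D : C) (i : A ⟶ D) (q : D ⟶ B), Fib.llp i ∧ IsSmallFibration p q ∧ i ≫ q = f

end FibrationCategory

/-! ## Fibrations of groupoids -/

section Groupoids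

variable {A : Type*} {B : Type*} [Groupoid A] [Groupoid B]

/-- Fibrations of the natural model structure on groupoids: every (iso)morphism `φ` of the target
with a given object `a` above its domain has a lift starting at `a`. -/
def IsGroupoidFibration (F : A ⥤ B) : Prop :=
  ∀ (a : A) {b : B} (φ : F.obj a ⟶ b), ∃ (a' : A) (ψ : a ⟶ a'), F.IsHomLift φ ψ

/-- Discrete fibrations of groupoids: fibrations for which the lifts (a morphism together with its
codomain) are unique. -/
def IsDiscreteGroupoidFibration (F : A ⥤ B) : Prop :=
  IsGroupoidFibration F ∧
    ∀ (a : A) {b : B} (φ : F.obj a ⟶ b), ∃! l : (a' : A) × (a ⟶ a'), F.IsHomLift φ l.2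

end Groupoids

/-! ## Groupoids with an involution -/

/-- The functor category `[B(ℤ/2), Gpd]`. -/
abbrev GpdZ2 : Type (w + 1) := SingleObj (Multiplicative (ZMod 2)) ⥤ Grpd.{w, w}

namespace GpdZ2

/-- The underlying groupoid. -/
abbrev underlying (G : GpdZ2.{w}) : Grpd.{w, w} := G.obj (SingleObj.star _)

/-- The underlying functor of a morphism. -/
abbrev underlyingMap {G H : GpdZ2.{w}} (f : G ⟶ H) : G.underlying ⥤ H.underlying :=
  f.app (SingleObj.star _)

/-- The projective fibrations: morphisms whose underlying functor is a fibration. -/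
def projectiveFibrations : MorphismProperty GpdZ2.{w} :=
  fun _ _ f => IsGroupoidFibration (underlyingMap f)

theorem eq_ofAdd_one {s : Multiplicative (ZMod 2)} (h : s ≠ 1) : s = Multiplicative.ofAdd 1 := by
  revert s; decide

/-- The action of `ℤ/2` given by an involution. -/
def act {G : Type w} [Groupoid.{w} G] (ι : G ⥤ G) (s : Multiplicative (ZMod 2)) : G ⥤ G :=
  if s = 1 then 𝟭 G else ι

/-- A groupoid with an involution, as a functor on `B(ℤ/2)`. -/
def ofInvolution (G : Grpd.{w, w}) (ι : G ⥤ G) (h : ι ⋙ ι = 𝟭 G) : GpdZ2.{w} where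
  obj _ := G
  map s := act ι s
  map_id _ := if_pos rfl
  map_comp {_ _ _} s t := by
    change Multiplicative (ZMod 2) at s t
    change act ι (t * s) = act ι s ⋙ act ι t
    by_cases hs : s = 1
    · subst hs
      rw [mul_one, act, act, if_pos rfl]
      rfl
    · by_cases ht : t = 1
      · subst ht
        rw [one_mul, act, act, if_pos rfl]
        rfl
      · obtain rfl := eq_ofAdd_one hs
        obtain rfl := eq_ofAdd_one ht
        rw [act, act, if_neg hs, h, if_pos (by decide)]

/-- An equivariant functor, as a natural transformation. -/
def ofEquivariant {G H : Grpd.{w, w}} {ι : G ⥤ G} {hι : ι ⋙ ι = 𝟭 G} {η : H ⥤ H}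
    {hη : η ⋙ η = 𝟭 H} (F : G ⥤ H) (hF : ι ⋙ F = F ⋙ η) :
    ofInvolution G ι hι ⟶ ofInvolution H η hη where
  app _ := F
  naturality {_ _} s := by
    change Multiplicative (ZMod 2) at s
    change act ι s ⋙ F = F ⋙ act η s
    by_cases hs : s = 1
    · rw [act, act, if_pos hs, if_pos hs]
      rfl
    · rw [act, act, if_neg hs, if_neg hs, hF]

end GpdZ2

/-! ## The universe -/

open scoped Cardinal

/-- Objects of `U`: pairs of `κ`-small discrete groupoids with an isomorphism between them. -/
structure UObj (κ : Cardinal.{u}) : Type (u + 1) where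
  fst : Grpd.{u, u}
  snd : Grpd.{u, u}
  fst_discrete : IsDiscrete fst
  snd_discrete : IsDiscrete snd
  fst_small : #fst < κ
  snd_small : #snd < κ
  iso : fst ≅ snd

/-- Morphisms of `U`: pairs `(ρ, τ)` of isomorphisms with `ψ ∘ ρ = τ ∘ φ`. -/
@[ext]
structure UHom {κ : Cardinal.{u}} (X Y : UObj κ) : Type (u + 1) where
  fst : X.fst ≅ Y.fst
  snd : X.snd ≅ Y.snd
  comm : fst.hom ≫ Y.iso.hom = X.iso.hom ≫ snd.hom

/-- The groupoid `U`. -/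
instance UObj.groupoid (κ : Cardinal.{u}) : Groupoid.{u + 1} (UObj κ) where
  Hom X Y := UHom X Y
  id X := ⟨Iso.refl _, Iso.refl _, by simp⟩
  comp f g := ⟨f.fst ≪≫ g.fst, f.snd ≪≫ g.snd, by simp [g.comm, reassoc_of% f.comm]⟩
  id_comp _ := by ext1 <;> simp
  comp_id _ := by ext1 <;> simp
  assoc _ _ _ := by ext1 <;> simp
  inv {X Y} f := ⟨f.fst.symm, f.snd.symm, by
    rw [Iso.symm_hom, Iso.symm_hom, Iso.inv_comp_eq, ← Category.assoc, f.comm, Category.assoc,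
      Iso.hom_inv_id, Category.comp_id]⟩
  inv_comp _ := by ext1 <;> simp
  comp_inv _ := by ext1 <;> simp

/-- Objects of `Ũ`: objects `(A, B, φ)` of `U` with an object `a` of `A`. -/
structure PtUObj (κ : Cardinal.{u}) : Type (u + 1) where
  base : UObj κ
  pt : base.fst

/-- Morphisms of `Ũ`: morphisms `(ρ, τ)` of `U` such that `ρ` preserves the points. -/
@[ext]
structure PtUHom {κ : Cardinal.{u}} (X Y : PtUObj κ) : Type (u + 1) where
  base : X.base ⟶ Y.base
  map_pt : (UHom.fst base).hom.obj X.pt = Y.pt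

/-- The groupoid `Ũ`. -/
instance PtUObj.groupoid (κ : Cardinal.{u}) : Groupoid.{u + 1} (PtUObj κ) where
  Hom X Y := PtUHom X Y
  id X := ⟨𝟙 X.base, rfl⟩
  comp {X Y Z} f g := ⟨f.base ≫ g.base, by
    change (UHom.fst g.base).hom.obj ((UHom.fst f.base).hom.obj X.pt) = Z.pt
    rw [f.map_pt, g.map_pt]⟩
  id_comp _ := PtUHom.ext (Category.id_comp _)
  comp_id _ := PtUHom.ext (Category.comp_id _)
  assoc _ _ _ := PtUHom.ext (Category.assoc _ _ _)
  inv {X Y} f := ⟨Groupoid.inv f.base, by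
    change (UHom.fst f.base).inv.obj Y.pt = X.pt
    rw [← f.map_pt]
    exact Functor.congr_obj (UHom.fst f.base).hom_inv_id X.pt⟩
  inv_comp _ := PtUHom.ext (Groupoid.inv_comp _)
  comp_inv _ := PtUHom.ext (Groupoid.comp_inv _)

/-- The involution of `U`: `(A, B, φ) ↦ (B, A, φ⁻¹)` and `(ρ, τ) ↦ (τ, ρ)`. -/
def UObj.swap (κ : Cardinal.{u}) : UObj κ ⥤ UObj κ where
  obj X := ⟨X.snd, X.fst, X.snd_discrete, X.fst_discrete, X.snd_small, X.fst_small, X.iso.symm⟩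
  map {X Y} f := (⟨UHom.snd f, UHom.fst f, by
    rw [Iso.symm_hom, Iso.symm_hom, Iso.comp_inv_eq, Category.assoc, UHom.comm f,
      Iso.inv_hom_id_assoc]⟩ : UHom _ _)
  map_id _ := rfl
  map_comp _ _ := rfl

/-- The involution of `Ũ`: `(A, B, φ, a) ↦ (B, A, φ⁻¹, φ(a))` and `(ρ, τ) ↦ (τ, ρ)`. -/
def PtUObj.swap (κ : Cardinal.{u}) : PtUObj κ ⥤ PtUObj κ where
  obj X := ⟨(UObj.swap κ).obj X.base, X.base.iso.hom.obj X.pt⟩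
  map {X Y} f := (⟨(UObj.swap κ).map f.base, by
    change (X.base.iso.hom ≫ (UHom.snd f.base).hom).obj X.pt = Y.base.iso.hom.obj Y.pt
    rw [← UHom.comm f.base, ← f.map_pt]
    rfl⟩ : PtUHom _ _)
  map_id _ := rfl
  map_comp _ _ := rfl

/-- The projection `(A, B, φ, a) ↦ (A, B, φ)`, `(ρ, τ) ↦ (ρ, τ)`. -/
def PtUObj.proj (κ : Cardinal.{u}) : PtUObj κ ⥤ UObj κ where
  obj X := X.base
  map f := PtUHom.base f

theorem UObj.swap_swap (κ : Cardinal.{u}) : UObj.swap κ ⋙ UObj.swap κ = 𝟭 (UObj κ) := rfl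

theorem PtUObj.swap_obj_swap {κ : Cardinal.{u}} (X : PtUObj κ) :
    (PtUObj.swap κ).obj ((PtUObj.swap κ).obj X) = X := by
  obtain ⟨X, a⟩ := X
  change (⟨X, X.iso.inv.obj (X.iso.hom.obj a)⟩ : PtUObj κ) = ⟨X, a⟩
  have h : X.iso.inv.obj (X.iso.hom.obj a) = a := Functor.congr_obj X.iso.hom_inv_id a
  rw [h]

theorem PtUHom.hext {κ : Cardinal.{u}} {X Y X' Y' : PtUObj κ} (hX : X = X') (hY : Y = Y')
    (f : X ⟶ Y) (g : X' ⟶ Y') (h : HEq (PtUHom.base f) (PtUHom.base g)) : HEq f g := by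
  subst hX hY
  exact heq_of_eq (PtUHom.ext (eq_of_heq h))

theorem PtUObj.swap_swap (κ : Cardinal.{u}) :
    PtUObj.swap κ ⋙ PtUObj.swap κ = 𝟭 (PtUObj κ) :=
  Functor.hext PtUObj.swap_obj_swap fun X Y _ =>
    PtUHom.hext (PtUObj.swap_obj_swap X) (PtUObj.swap_obj_swap Y) _ _ HEq.rfl

/-- The object `U` of `Gpd^{ℤ/2}`. -/
def universeBase (κ : Cardinal.{u}) : GpdZ2.{u + 1} :=
  GpdZ2.ofInvolution (Grpd.of (UObj κ)) (UObj.swap κ) (UObj.swap_swap κ)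

/-- The object `Ũ` of `Gpd^{ℤ/2}`. -/
def universeTotal (κ : Cardinal.{u}) : GpdZ2.{u + 1} :=
  GpdZ2.ofInvolution (Grpd.of (PtUObj κ)) (PtUObj.swap κ) (PtUObj.swap_swap κ)

/-- The morphism `p : Ũ ⟶ U` of `Gpd^{ℤ/2}`. -/
def universeProj (κ : Cardinal.{u}) : universeTotal κ ⟶ universeBase κ :=
  GpdZ2.ofEquivariant (PtUObj.proj κ) rfl

/-! ## Lifts along functors of groupoids -/

section Lifts

/-! Limits and fibrations in `GpdZ2` are tested on underlying groupoids, so terminal objects and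
pullbacks reduce to strict pullbacks in `Grpd`. Dependent products and factorizations need
constructions that respect the group action.

Dependent products: over `b`, the objects of `Π_g f` are the sections of `f` over the fibre of `g`
at `b`; a morphism over `β` assigns to each lift of `β` to the domain of `g` a morphism over that
lift. The universal property (`isUniversalSection_piEval`) is stated against every pullback square.
Twisting a square by a group element gives another pullback square, so universality itself produces
the action on `Π_g f` and the equivariance of the transposes
(`exists_isUniversalSection_of_singleObj`).

Factorization: the usual mapping path groupoid fails equivariantly, because lifts along a fibration
cannot be chosen equivariantly at paths with nontrivial stabilizer. Hence `PathObj` keeps the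
objects of `X` as they are, with identity paths, and labels all other paths with a group element, so
that the group permutes these freely. A lift may then be chosen at the label `1` and translated to
the other labels (`exists_equivariant_lift_canonical`), while the objects of `X` receive identities.
This gives the left lifting property against all projective fibrations
(`hasLiftingProperty_inclusion`).

Universe: small fibrations are exactly the discrete fibrations with fibres smaller than `κ`
(`isSmallFibration_universeProj_iff`). Such an `F : A ⥤ B` is classified by sending `b` to the
fibres over `b` and over its conjugate, with the bijection given by the involution of `A`; transport
along morphisms makes this a functor. The resulting square of discrete fibrations is a pullback
because it is one on objects. The closure properties become counting: regularity of `κ` handles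
composition, the strong limit property handles products of fibres, and a morphism between discrete
fibrations over a common base is again a discrete fibration, so it factors as an identity followed
by itself. -/

theorem isHomLift_of_comp_eq {H A B : Type*} [Category* H] [Category* A] [Category* B]
    {v : H ⥤ A} {g : A ⥤ B} {h : H ⥤ B} (e : v ⋙ g = h) {x y : H} (k : x ⟶ y) :
    g.IsHomLift (h.map k) (v.map k) := by
  subst e
  exact .map _

theorem comp_eq_of_isHomLift {H A B : Type*} [Category* H] [Category* A] [Category* B]
    {v : H ⥤ A} {g : A ⥤ B} {h : H ⥤ B}
    (e : ∀ {x y : H} (k : x ⟶ y), g.IsHomLift (h.map k) (v.map k)) : v ⋙ g = h := by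
  refine CategoryTheory.Functor.ext (fun x => ?_) fun x y k => ?_
  · have := e (𝟙 x)
    exact IsHomLift.domain_eq g (h.map (𝟙 x)) (v.map (𝟙 x))
  · have := e k
    exact IsHomLift.fac' g (h.map k) (v.map k)

theorem isHomLift_comp_iff {A B C : Type*} [Category* A] [Category* B] [Category* C]
    (F : A ⥤ B) (G : B ⥤ C) {R S : C} (φ : R ⟶ S) {a a' : A} (ψ : a ⟶ a') :
    (F ⋙ G).IsHomLift φ ψ ↔ G.IsHomLift φ (F.map ψ) := by
  constructor
  · intro h
    have := IsHomLift.fac' (F ⋙ G) φ ψ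
    exact IsHomLift.of_fac' G φ (F.map ψ) (IsHomLift.domain_eq (F ⋙ G) φ ψ)
      (IsHomLift.codomain_eq (F ⋙ G) φ ψ) this
  · intro h
    have := IsHomLift.fac' G φ (F.map ψ)
    exact IsHomLift.of_fac' (F ⋙ G) φ ψ (IsHomLift.domain_eq G φ (F.map ψ))
      (IsHomLift.codomain_eq G φ (F.map ψ)) this

theorem isHomLift_comp {A B C : Type*} [Category* A] [Category* B] [Category* C]
    {F : A ⥤ B} {G : B ⥤ C} {R S : C} {φ : R ⟶ S} {b b' : B} {χ : b ⟶ b'} {a a' : A} {ψ : a ⟶ a'}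
    (h₁ : G.IsHomLift φ χ) (h₂ : F.IsHomLift χ ψ) : (F ⋙ G).IsHomLift φ ψ := by
  obtain ⟨⟩ := h₂
  exact (isHomLift_comp_iff F G φ ψ).2 h₁

theorem isHomLift_of_heq {A B : Type*} [Category* A] [Category* B] {F : A ⥤ B} {R S S' : B}
    {φ : R ⟶ S} {φ' : R ⟶ S'} (hS : S = S') (hφ : φ ≍ φ') {a a' : A} {ψ : a ⟶ a'}
    (h : F.IsHomLift φ ψ) : F.IsHomLift φ' ψ := by
  subst hS
  rwa [← eq_of_heq hφ]

theorem map_heq_of_isHomLift {A B : Type*} [Category* A] [Category* B] {F : A ⥤ B} {R S : B}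
    {φ : R ⟶ S} {a a' : A} {ψ : a ⟶ a'} (h : F.IsHomLift φ ψ) : F.map ψ ≍ φ := by
  obtain ⟨⟩ := h
  rfl

variable {A B C : Type*} [Groupoid A] [Groupoid B] [Groupoid C]

theorem IsGroupoidFibration.exists_lift {F : A ⥤ B} (hF : IsGroupoidFibration F) {R S : B}
    (φ : R ⟶ S) (a : A) (ha : F.obj a = R) : ∃ (a' : A) (ψ : a ⟶ a'), F.IsHomLift φ ψ := by
  subst ha
  exact hF a φ

theorem isHomLift_inv {F : A ⥤ B} {R S : B} (φ : R ⟶ S) {a a' : A} (ψ : a ⟶ a')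
    [F.IsHomLift φ ψ] : F.IsHomLift (inv φ) (inv ψ) := inferInstance

theorem IsGroupoidFibration.exists_lift_to {F : A ⥤ B} (hF : IsGroupoidFibration F) {R S : B}
    (φ : R ⟶ S) (a' : A) (ha : F.obj a' = S) : ∃ (a : A) (ψ : a ⟶ a'), F.IsHomLift φ ψ := by
  obtain ⟨a, ψ, h⟩ := hF.exists_lift (inv φ) a' ha
  refine ⟨a, inv ψ, ?_⟩
  have := isHomLift_inv (F := F) (inv φ) ψ
  rwa [IsIso.inv_inv] at this

theorem IsDiscreteGroupoidFibration.lift_unique {F : A ⥤ B} (hF : IsDiscreteGroupoidFibration F)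
    {R S : B} (φ : R ⟶ S) {a a₁ a₂ : A} (ψ₁ : a ⟶ a₁) (ψ₂ : a ⟶ a₂)
    (h₁ : F.IsHomLift φ ψ₁) (h₂ : F.IsHomLift φ ψ₂) : a₁ = a₂ ∧ ψ₁ ≍ ψ₂ := by
  obtain rfl := IsHomLift.domain_eq F φ ψ₁
  have := (hF.2 a φ).unique (y₁ := ⟨a₁, ψ₁⟩) (y₂ := ⟨a₂, ψ₂⟩) h₁ h₂
  simpa using this

theorem IsDiscreteGroupoidFibration.lift_eq {F : A ⥤ B} (hF : IsDiscreteGroupoidFibration F)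
    {R S : B} (φ : R ⟶ S) {a a' : A} (ψ₁ ψ₂ : a ⟶ a')
    (h₁ : F.IsHomLift φ ψ₁) (h₂ : F.IsHomLift φ ψ₂) : ψ₁ = ψ₂ :=
  eq_of_heq (hF.lift_unique φ ψ₁ ψ₂ h₁ h₂).2

theorem isDiscreteGroupoidFibration_of_exists_of_unique {F : A ⥤ B}
    (h₁ : IsGroupoidFibration F)
    (h₂ : ∀ (a : A) {b : B} (φ : F.obj a ⟶ b) {a₁ a₂ : A} (ψ₁ : a ⟶ a₁) (ψ₂ : a ⟶ a₂),
      F.IsHomLift φ ψ₁ → F.IsHomLift φ ψ₂ → a₁ = a₂ ∧ ψ₁ ≍ ψ₂) :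
    IsDiscreteGroupoidFibration F := by
  refine ⟨h₁, fun a b φ => ?_⟩
  obtain ⟨a', ψ, h⟩ := h₁ a φ
  refine ⟨⟨a', ψ⟩, h, fun l hl => ?_⟩
  obtain ⟨a'', ψ'⟩ := l
  obtain ⟨rfl, h'⟩ := h₂ a φ ψ' ψ hl h
  obtain rfl := eq_of_heq h'
  rfl

theorem IsGroupoidFibration.comp {F : A ⥤ B} {G : B ⥤ C} (hF : IsGroupoidFibration F)
    (hG : IsGroupoidFibration G) : IsGroupoidFibration (F ⋙ G) := by
  intro a c φ
  obtain ⟨b, χ, hχ⟩ := hG (F.obj a) φ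
  obtain ⟨a', ψ, hψ⟩ := hF a χ
  exact ⟨a', ψ, isHomLift_comp hχ hψ⟩

theorem IsDiscreteGroupoidFibration.comp {F : A ⥤ B} {G : B ⥤ C}
    (hF : IsDiscreteGroupoidFibration F) (hG : IsDiscreteGroupoidFibration G) :
    IsDiscreteGroupoidFibration (F ⋙ G) := by
  refine isDiscreteGroupoidFibration_of_exists_of_unique (hF.1.comp hG.1) ?_
  intro a b φ a₁ a₂ ψ₁ ψ₂ h₁ h₂
  rw [isHomLift_comp_iff] at h₁ h₂
  obtain ⟨e, he⟩ := hG.lift_unique φ _ _ h₁ h₂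
  exact hF.lift_unique (F.map ψ₁) ψ₁ ψ₂ inferInstance
    (isHomLift_of_heq e.symm he.symm (.map ψ₂))

theorem isDiscreteGroupoidFibration_of_inverse {F : A ⥤ B} {G : B ⥤ A} (h₁ : F ⋙ G = 𝟭 A)
    (h₂ : G ⋙ F = 𝟭 B) : IsDiscreteGroupoidFibration F := by
  refine isDiscreteGroupoidFibration_of_exists_of_unique ?_ ?_
  · intro a b φ
    have ha : G.obj (F.obj a) = a := Functor.congr_obj h₁ a
    refine ⟨G.obj b, eqToHom ha.symm ≫ G.map φ, ?_⟩
    have := isHomLift_of_comp_eq h₂ φ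
    rw [Functor.id_map] at this
    infer_instance
  · intro a b φ a₁ a₂ ψ₁ ψ₂ h h'
    have key : ∀ {R S : B} {φ : R ⟶ S} {x y : A} (ψ : x ⟶ y), F.IsHomLift φ ψ →
        y = G.obj S ∧ ψ ≍ G.map φ := by
      intro R S φ x y ψ h
      obtain ⟨⟩ := h
      exact ⟨(Functor.congr_obj h₁ y).symm, (Functor.hcongr_hom h₁ ψ).symm⟩
    exact ⟨(key ψ₁ h).1.trans (key ψ₂ h').1.symm, (key ψ₁ h).2.trans (key ψ₂ h').2.symm⟩

/-- A functor between discrete fibrations is a discrete fibration. -/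
theorem IsDiscreteGroupoidFibration.of_comp {F : A ⥤ B} {G : B ⥤ C}
    (hFG : IsDiscreteGroupoidFibration (F ⋙ G)) (hG : IsDiscreteGroupoidFibration G) :
    IsDiscreteGroupoidFibration F := by
  refine isDiscreteGroupoidFibration_of_exists_of_unique ?_ ?_
  · intro a b φ
    -- The image under `F` of a lift of `G.map φ` along `F ⋙ G`, and `φ` itself, are both lifts
    -- along `G` with the same domain, so they coincide.
    obtain ⟨a', ψ, h⟩ := hFG.1 a (G.map φ)
    refine ⟨a', ψ, ?_⟩
    rw [isHomLift_comp_iff] at h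
    obtain ⟨rfl, h⟩ := hG.lift_unique (G.map φ) φ (F.map ψ) inferInstance h
    obtain rfl := eq_of_heq h
    infer_instance
  · intro a b φ a₁ a₂ ψ₁ ψ₂ h₁ h₂
    exact hFG.lift_unique (G.map φ) ψ₁ ψ₂ (isHomLift_comp inferInstance h₁)
      (isHomLift_comp inferInstance h₂)

/-- A discrete fibration which is bijective on objects is an isomorphism. -/
theorem IsDiscreteGroupoidFibration.exists_inverse {F : A ⥤ B}
    (hF : IsDiscreteGroupoidFibration F) (hb : Function.Bijective F.obj) :
    ∃ G : B ⥤ A, F ⋙ G = 𝟭 A ∧ G ⋙ F = 𝟭 B := by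
  -- Fullness: lift `φ`; injectivity on objects identifies the codomain of the lift with `y`.
  have hmap : ∀ {x y : A} (φ : F.obj x ⟶ F.obj y), ∃ ψ : x ⟶ y, F.map ψ = φ := by
    intro x y φ
    obtain ⟨y', ψ, h⟩ := hF.1 x φ
    obtain rfl := hb.1 (IsHomLift.codomain_eq F φ ψ)
    exact ⟨ψ, (IsHomLift.eq_of_isHomLift F φ ψ).symm⟩
  have hinj : ∀ {x y : A} (φ ψ : x ⟶ y), F.map φ = F.map ψ → φ = ψ := by
    intro x y φ ψ h
    refine hF.lift_eq (F.map φ) φ ψ inferInstance ?_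
    rw [h]
    infer_instance
  obtain ⟨s, hs⟩ := Function.bijective_iff_has_inverse.1 hb
  choose m hm using @hmap
  let G : B ⥤ A :=
    { obj := s
      map := fun {x y} φ => m (eqToHom (hs.2 x) ≫ φ ≫ eqToHom (hs.2 y).symm)
      map_id := fun x => hinj _ _ (by simp [hm])
      map_comp := fun φ ψ => hinj _ _ (by simp [hm]) }
  have h₂ : G ⋙ F = 𝟭 B := CategoryTheory.Functor.ext hs.2 fun x y φ => by simp [G, hm]
  refine ⟨G, ?_, h₂⟩
  refine CategoryTheory.Functor.ext hs.1 fun x y φ => hinj _ _ ?_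
  simp [G, hm, eqToHom_map]

end Lifts

/-! ## Cardinality of fibres -/

section Fibres

variable {A B C : Type w} [Groupoid.{w} A] [Groupoid.{w} B] [Groupoid.{w} C]

/-- Discrete fibrations all of whose fibres have cardinality less than `c`. -/
structure IsSmallDiscreteFibration (c : Cardinal.{w}) (F : A ⥤ B) : Prop where
  discrete : IsDiscreteGroupoidFibration F
  card_lt : ∀ b, #(F.Fiber b) < c

/-- A fibre of the composite embeds in the disjoint union of fibres of `F` indexed by a fibre of
`G`, and regularity bounds this union. -/
theorem IsSmallDiscreteFibration.comp {c : Cardinal.{w}} (hc : c.IsRegular) {F : A ⥤ B}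
    {G : B ⥤ C} (hF : IsSmallDiscreteFibration c F) (hG : IsSmallDiscreteFibration c G) :
    IsSmallDiscreteFibration c (F ⋙ G) := by
  refine ⟨hF.discrete.comp hG.discrete, fun z => ?_⟩
  have : #((F ⋙ G).Fiber z) ≤ #(Σ y : G.Fiber z, F.Fiber y.1) :=
    Cardinal.mk_le_of_injective (f := fun x => ⟨⟨F.obj x.1, x.2⟩, ⟨x.1, rfl⟩⟩) (by
      intro x y h
      exact Subtype.ext (congrArg (fun p : Σ y : G.Fiber z, F.Fiber y.1 => p.2.1) h))
  refine this.trans_lt ?_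
  rw [Cardinal.mk_sigma]
  exact Cardinal.sum_lt_of_isRegular hc (hG.card_lt z) fun y => hF.card_lt y.1

theorem isSmallDiscreteFibration_of_inverse {c : Cardinal.{w}} (hc : 1 < c) {F : A ⥤ B}
    {G : B ⥤ A} (h₁ : F ⋙ G = 𝟭 A) (h₂ : G ⋙ F = 𝟭 B) : IsSmallDiscreteFibration c F := by
  refine ⟨isDiscreteGroupoidFibration_of_inverse h₁ h₂, fun b => lt_of_le_of_lt ?_ hc⟩
  rw [Cardinal.le_one_iff_subsingleton]
  refine ⟨fun x y => Subtype.ext ?_⟩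
  have key : ∀ x : F.Fiber b, x.1 = G.obj b := fun x =>
    (Functor.congr_obj h₁ x.1).symm.trans (congrArg G.obj x.2)
  rw [key, key]

/-- The fibre of `F` over `b` embeds in the fibre of the composite over `G.obj b`. Thus a morphism
between small fibrations over a common base is itself small. -/
theorem IsSmallDiscreteFibration.of_comp {c : Cardinal.{w}} {F : A ⥤ B} {G : B ⥤ C}
    (hFG : IsSmallDiscreteFibration c (F ⋙ G)) (hG : IsDiscreteGroupoidFibration G) :
    IsSmallDiscreteFibration c F :=
  ⟨hFG.discrete.of_comp hG, fun b => (Cardinal.mk_le_of_injective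
    (f := fun x : F.Fiber b => (⟨x.1, congrArg G.obj x.2⟩ : (F ⋙ G).Fiber (G.obj b)))
      fun _ _ h => Subtype.ext (congrArg (fun z => z.1) h)).trans_lt (hFG.card_lt _)⟩

end Fibres

/-! ## Strict pullbacks of groupoids -/

section StrictPullback

variable {H A B K : Type w} [Groupoid.{w} H] [Groupoid.{w} A] [Groupoid.{w} B] [Groupoid.{w} K]

/-- Objects of the strict pullback of two functors. -/
@[ext]
structure StrictPullback (h : H ⥤ B) (g : A ⥤ B) : Type w where
  fst : H
  snd : A
  w : g.obj snd = h.obj fst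

namespace StrictPullback

/-- Morphisms of the strict pullback. -/
@[ext]
structure Hom {h : H ⥤ B} {g : A ⥤ B} (x y : StrictPullback h g) : Type w where
  fst : x.fst ⟶ y.fst
  snd : x.snd ⟶ y.snd
  w : g.IsHomLift (h.map fst) snd

variable {h : H ⥤ B} {g : A ⥤ B}

noncomputable instance : Groupoid.{w} (StrictPullback h g) where
  Hom := Hom
  id x := ⟨𝟙 _, 𝟙 _, by rw [h.map_id]; exact IsHomLift.id x.w⟩
  comp m n := ⟨m.fst ≫ n.fst, m.snd ≫ n.snd, by
    have := m.w
    have := n.w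
    rw [h.map_comp]
    infer_instance⟩
  id_comp _ := Hom.ext (Category.id_comp _) (Category.id_comp _)
  comp_id _ := Hom.ext (Category.comp_id _) (Category.comp_id _)
  assoc _ _ _ := Hom.ext (Category.assoc _ _ _) (Category.assoc _ _ _)
  inv m := ⟨inv m.fst, inv m.snd, by
    have := m.w
    rw [h.map_inv]
    infer_instance⟩
  inv_comp _ := Hom.ext (IsIso.inv_hom_id _) (IsIso.inv_hom_id _)
  comp_inv _ := Hom.ext (IsIso.hom_inv_id _) (IsIso.hom_inv_id _)

/-- Morphisms of the strict pullback, with implicit compatibility of the objects. -/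
def homMk {y y' : H} {a a' : A} (η : y ⟶ y') (α : a ⟶ a') (i : g.IsHomLift (h.map η) α) :
    (⟨y, a, IsHomLift.domain_eq g (h.map η) α⟩ : StrictPullback h g) ⟶
      ⟨y', a', IsHomLift.codomain_eq g (h.map η) α⟩ :=
  (⟨η, α, i⟩ : Hom _ _)

theorem Hom.hext {x y x' y' : StrictPullback h g} (hx : x = x') (hy : y = y') (m : x ⟶ y)
    (n : x' ⟶ y') (h₁ : Hom.fst m ≍ Hom.fst n) (h₂ : Hom.snd m ≍ Hom.snd n) : m ≍ n := by
  subst hx hy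
  exact heq_of_eq (Hom.ext (eq_of_heq h₁) (eq_of_heq h₂))

variable (h g) in
/-- The first projection. -/
def fstFunctor : StrictPullback h g ⥤ H where
  obj x := x.fst
  map m := Hom.fst m

variable (h g) in
/-- The second projection. -/
def sndFunctor : StrictPullback h g ⥤ A where
  obj x := x.snd
  map m := Hom.snd m

variable (h g) in
theorem condition : fstFunctor h g ⋙ h = sndFunctor h g ⋙ g :=
  (comp_eq_of_isHomLift fun {_ _} m => Hom.w m).symm

/-- The functor into the strict pullback given by a commutative square. -/
def lift (u : K ⥤ H) (v : K ⥤ A) (e : u ⋙ h = v ⋙ g) : K ⥤ StrictPullback h g where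
  obj x := ⟨u.obj x, v.obj x, (Functor.congr_obj e x).symm⟩
  map m := (⟨u.map m, v.map m, isHomLift_of_comp_eq e.symm m⟩ : Hom _ _)
  map_id x := Hom.ext (u.map_id x) (v.map_id x)
  map_comp m n := Hom.ext (u.map_comp m n) (v.map_comp m n)

theorem functor_ext {m n : K ⥤ StrictPullback h g}
    (h₁ : m ⋙ fstFunctor h g = n ⋙ fstFunctor h g)
    (h₂ : m ⋙ sndFunctor h g = n ⋙ sndFunctor h g) : m = n :=
  have e := fun x => StrictPullback.ext (Functor.congr_obj h₁ x) (Functor.congr_obj h₂ x)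
  Functor.hext e fun x y k =>
    Hom.hext (e x) (e y) _ _ (Functor.hcongr_hom h₁ k) (Functor.hcongr_hom h₂ k)

theorem isGroupoidFibration_fst (hg : IsGroupoidFibration g) :
    IsGroupoidFibration (fstFunctor h g) := by
  rintro ⟨y, a, e⟩ y' (φ : y ⟶ y')
  obtain ⟨a', ψ, hψ⟩ := hg.exists_lift (h.map φ) a e
  let m : (⟨y, a, e⟩ : StrictPullback h g) ⟶ ⟨y', a', IsHomLift.codomain_eq g (h.map φ) ψ⟩ :=
    (⟨φ, ψ, hψ⟩ : Hom _ _)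
  have hm : (fstFunctor h g).IsHomLift ((fstFunctor h g).map m) m := .map m
  exact ⟨_, m, hm⟩

theorem isDiscreteGroupoidFibration_fst (hg : IsDiscreteGroupoidFibration g) :
    IsDiscreteGroupoidFibration (fstFunctor h g) := by
  refine isDiscreteGroupoidFibration_of_exists_of_unique (isGroupoidFibration_fst hg.1) ?_
  intro x y' φ x₁ x₂ ψ₁ ψ₂ h₁ h₂
  obtain rfl := IsHomLift.codomain_eq (fstFunctor h g) φ ψ₁
  obtain rfl : φ = (fstFunctor h g).map ψ₁ := IsHomLift.eq_of_isHomLift (fstFunctor h g) φ ψ₁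
  obtain ⟨y₂, a₂, e₂⟩ := x₂
  obtain rfl := IsHomLift.codomain_eq (fstFunctor h g) ((fstFunctor h g).map ψ₁) ψ₂
  have h₃ : ψ₁.fst = ψ₂.fst :=
    @IsHomLift.eq_of_isHomLift _ _ _ _ (fstFunctor h g) x ⟨x₁.fst, a₂, e₂⟩ (Hom.fst ψ₁) ψ₂ h₂
  obtain ⟨h₄, h₅⟩ := hg.lift_unique (h.map ψ₁.fst) ψ₁.snd ψ₂.snd ψ₁.w (by
    have := ψ₂.w
    rwa [← h₃] at this)
  have h₆ : x₁ = ⟨x₁.fst, a₂, e₂⟩ := StrictPullback.ext rfl h₄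
  exact ⟨h₆, Hom.hext rfl h₆ _ _ (heq_of_eq h₃) h₅⟩

theorem isSmallDiscreteFibration_fst {c : Cardinal.{w}} (hg : IsSmallDiscreteFibration c g) :
    IsSmallDiscreteFibration c (fstFunctor h g) := by
  refine ⟨isDiscreteGroupoidFibration_fst hg.discrete, fun y =>
    (Cardinal.mk_le_of_injective (β := g.Fiber (h.obj y))
      (f := fun x => ⟨x.1.snd, x.1.w.trans (congrArg h.obj x.2)⟩) ?_).trans_lt
    (hg.card_lt (h.obj y))⟩
  intro x x' e
  exact Subtype.ext (StrictPullback.ext (x.2.trans x'.2.symm) (congrArg (fun z => z.1) e))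

end StrictPullback

end StrictPullback

/-! ## Limits of groupoids -/

namespace CategoryTheory.Grpd

variable {H A B : Grpd.{w, w}} (h : H ⟶ B) (g : A ⟶ B)

/-- The strict pullback as an object of the category of groupoids. -/
noncomputable abbrev strictPullback : Grpd.{w, w} :=
  Grpd.of (StrictPullback (h : H ⥤ B) (g : A ⥤ B))

/-- The first projection of the strict pullback. -/
noncomputable def pullbackFst : strictPullback h g ⟶ H :=
  StrictPullback.fstFunctor (h : H ⥤ B) (g : A ⥤ B)

/-- The second projection of the strict pullback. -/
noncomputable def pullbackSnd : strictPullback h g ⟶ A :=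
  StrictPullback.sndFunctor (h : H ⥤ B) (g : A ⥤ B)

theorem isPullback_strictPullback :
    IsPullback (pullbackFst h g) (pullbackSnd h g) h g :=
  ⟨⟨StrictPullback.condition (h : H ⥤ B) (g : A ⥤ B)⟩,
    ⟨PullbackCone.IsLimit.mk _
      (fun s => StrictPullback.lift (s.fst : s.pt ⥤ H) (s.snd : s.pt ⥤ A) s.condition)
      (fun _ => rfl) (fun _ => rfl)
      (fun s m h₁ h₂ => StrictPullback.functor_ext (h := (h : H ⥤ B)) (g := (g : A ⥤ B))
        (K := s.pt) (m := m) h₁ h₂)⟩⟩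

instance hasPullbacks : HasPullbacks Grpd.{w, w} := by
  have : ∀ {X Y Z : Grpd.{w, w}} {f : X ⟶ Z} {g : Y ⟶ Z}, HasLimit (cospan f g) :=
    fun {_ _ _ f g} => (isPullback_strictPullback f g).hasPullback
  exact hasPullbacks_of_hasLimit_cospan _

/-- The discrete groupoid with one object is terminal. -/
def isTerminalPUnit : IsTerminal (Grpd.of (Discrete PUnit.{w + 1}) : Grpd.{w, w}) :=
  IsTerminal.ofUniqueHom (fun X => Functor.star X) fun X m =>
    Functor.punit_ext' (C := X) m (Functor.star X)

instance hasTerminal : HasTerminal Grpd.{w, w} := isTerminalPUnit.hasTerminal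

/-- A terminal groupoid is strictly isomorphic to the point, so each of its arrows is an identity
and is lifted by an identity. -/
theorem isGroupoidFibration_of_isTerminal {X T : Grpd.{w, w}} (hT : IsTerminal T) (F : X ⥤ T) :
    IsGroupoidFibration F := by
  let e : T ≅ Grpd.of (Discrete PUnit.{w + 1}) := hT.uniqueUpToIso isTerminalPUnit
  intro a b φ
  have hφ : ∀ {x y : T} (φ : x ⟶ y) (a : X), F.obj a = x → F.IsHomLift φ (𝟙 a) := by
    intro x y φ a ha
    have h₁ := e.hom_inv_id
    let F₁ : T ⥤ Discrete PUnit.{w + 1} := e.hom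
    let F₂ : Discrete PUnit.{w + 1} ⥤ T := e.inv
    have h₂ : F₁ ⋙ F₂ = 𝟭 T := e.hom_inv_id
    have h₃ : F₁.obj x = F₁.obj y := Subsingleton.elim _ _
    have h₄ : x = y := (Functor.congr_obj h₂ x).symm.trans
      ((congrArg F₂.obj h₃).trans (Functor.congr_obj h₂ y))
    subst h₄ ha
    have h₅ : φ = 𝟙 _ := by
      have h₆ := Functor.hcongr_hom h₂ φ
      have h₇ := Functor.hcongr_hom h₂ (𝟙 (F.obj a))
      have h₈ : (F₁ ⋙ F₂).map φ = (F₁ ⋙ F₂).map (𝟙 (F.obj a)) :=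
        congrArg F₂.map (Subsingleton.elim _ _)
      rw [h₈] at h₆
      exact (eq_of_heq (h₇.symm.trans h₆)).symm
    rw [h₅]
    infer_instance
  exact ⟨a, 𝟙 a, hφ φ a rfl⟩

theorem isDiscreteGroupoidFibration_of_isIso {X Y : Grpd.{w, w}} (F : X ⟶ Y) [IsIso F] :
    IsDiscreteGroupoidFibration (F : X ⥤ Y) :=
  isDiscreteGroupoidFibration_of_inverse (A := X) (B := Y) (F := F) (G := inv F)
    (IsIso.hom_inv_id F) (IsIso.inv_hom_id F)

theorem isSmallDiscreteFibration_of_isIso {c : Cardinal.{w}} (hc : 1 < c) {X Y : Grpd.{w, w}}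
    (F : X ⟶ Y) [IsIso F] : IsSmallDiscreteFibration c (F : X ⥤ Y) :=
  isSmallDiscreteFibration_of_inverse (A := X) (B := Y) hc (F := F) (G := inv F)
    (IsIso.hom_inv_id F) (IsIso.inv_hom_id F)

/-- Reduces stability under arbitrary pullback squares to the explicit model, since isomorphisms are
discrete fibrations. -/
theorem exists_iso_comp_of_isPullback {A' A B' B : Grpd.{w, w}} {t : A' ⟶ A} {g' : A' ⟶ B'}
    {g : A ⟶ B} {b : B' ⟶ B} (h : IsPullback t g' g b) :
    ∃ e : A' ≅ strictPullback b g, e.hom ≫ pullbackFst b g = g' :=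
  ⟨h.flip.isoIsPullback _ _ (isPullback_strictPullback b g), by simp⟩

theorem isGroupoidFibration_of_isPullback {A' A B' B : Grpd.{w, w}} {t : A' ⟶ A} {g' : A' ⟶ B'}
    {g : A ⟶ B} {b : B' ⟶ B} (h : IsPullback t g' g b)
    (hg : IsGroupoidFibration (g : A ⥤ B)) : IsGroupoidFibration (g' : A' ⥤ B') := by
  obtain ⟨e, rfl⟩ := exists_iso_comp_of_isPullback h
  exact IsGroupoidFibration.comp (A := A') (C := B')
    (isDiscreteGroupoidFibration_of_isIso e.hom).1
    (StrictPullback.isGroupoidFibration_fst (H := B') (A := A) (B := B) (h := b) hg)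

theorem isSmallDiscreteFibration_of_isPullback {c : Cardinal.{w}} (hc : c.IsRegular)
    {A' A B' B : Grpd.{w, w}} {t : A' ⟶ A} {g' : A' ⟶ B'} {g : A ⟶ B} {b : B' ⟶ B}
    (h : IsPullback t g' g b) (hg : IsSmallDiscreteFibration c (g : A ⥤ B)) :
    IsSmallDiscreteFibration c (g' : A' ⥤ B') := by
  obtain ⟨e, rfl⟩ := exists_iso_comp_of_isPullback h
  exact IsSmallDiscreteFibration.comp (A := A') (C := B') hc
    (isSmallDiscreteFibration_of_isIso (by simpa using hc.nat_lt 1) e.hom)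
    (StrictPullback.isSmallDiscreteFibration_fst (H := B') (A := A) (B := B) (h := b) hg)

/-- A commutative square of discrete fibrations which is a pullback on objects is a pullback. -/
theorem isPullback_of_isDiscreteGroupoidFibration {A' A B' B : Grpd.{w, w}} {t : A' ⟶ A}
    {g' : A' ⟶ B'} {g : A ⟶ B} {b : B' ⟶ B} (w : t ≫ g = g' ≫ b)
    (hg : IsDiscreteGroupoidFibration (g : A ⥤ B))
    (hg' : IsDiscreteGroupoidFibration (g' : A' ⥤ B'))
    (hinj : ∀ x y : A', (g' : A' ⥤ B').obj x = (g' : A' ⥤ B').obj y →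
      (t : A' ⥤ A).obj x = (t : A' ⥤ A).obj y → x = y)
    (hsurj : ∀ (y : B') (a : A), (g : A ⥤ B).obj a = (b : B' ⥤ B).obj y →
      ∃ x : A', (g' : A' ⥤ B').obj x = y ∧ (t : A' ⥤ A).obj x = a) :
    IsPullback t g' g b := by
  let F : A' ⥤ StrictPullback (b : B' ⥤ B) (g : A ⥤ B) :=
    StrictPullback.lift (g' : A' ⥤ B') (t : A' ⥤ A) w.symm
  -- The comparison functor lies over `B'` between two discrete fibrations, so it is one itself;
  -- bijectivity on objects then makes it an isomorphism.
  have hF : IsDiscreteGroupoidFibration F :=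
    IsDiscreteGroupoidFibration.of_comp (G := StrictPullback.fstFunctor _ _) hg'
      (StrictPullback.isDiscreteGroupoidFibration_fst hg)
  obtain ⟨G, h₁, h₂⟩ := hF.exists_inverse ⟨fun x y h => hinj x y
    (congrArg StrictPullback.fst h) (congrArg StrictPullback.snd h), fun z => by
      obtain ⟨x, hx, hx'⟩ := hsurj z.fst z.snd z.w
      exact ⟨x, StrictPullback.ext hx hx'⟩⟩
  let e : A' ≅ strictPullback b g := ⟨F, G, h₁, h₂⟩
  exact ((isPullback_strictPullback b g).of_iso e.symm (Iso.refl _) (Iso.refl _) (Iso.refl _)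
    ((Iso.eq_inv_comp e).2 rfl) ((Iso.eq_inv_comp e).2 rfl) rfl rfl).flip

end CategoryTheory.Grpd

/-! ## Dependent products of groupoids -/

section DependentProduct

variable {X A B : Type w} [Groupoid.{w} X] [Groupoid.{w} A] [Groupoid.{w} B]

/-- Objects of the dependent product of `f` along the fibration `g`: sections of `f` over a fibre
of `g`. -/
structure PiObj {g : A ⥤ B} (hg : IsGroupoidFibration g) (f : X ⥤ A) : Type w where
  base : B
  obj : ∀ a : A, g.obj a = base → X
  map : ∀ {a a' : A} (α : a ⟶ a') [g.IsHomLift (𝟙 base) α],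
    obj a (IsHomLift.domain_eq g (𝟙 base) α) ⟶ obj a' (IsHomLift.codomain_eq g (𝟙 base) α)
  lift : ∀ {a a' : A} (α : a ⟶ a') [g.IsHomLift (𝟙 base) α], f.IsHomLift α (map α)
  map_id : ∀ (a : A) [g.IsHomLift (𝟙 base) (𝟙 a)], map (𝟙 a) = 𝟙 _
  map_comp : ∀ {a a' a'' : A} (α : a ⟶ a') (α' : a' ⟶ a'') [g.IsHomLift (𝟙 base) α]
    [g.IsHomLift (𝟙 base) α'], map (α ≫ α') = map α ≫ map α'

variable {g : A ⥤ B} {hg : IsGroupoidFibration g} {f : X ⥤ A}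

/-- Morphisms of the dependent product. -/
structure PiHom (P Q : PiObj hg f) : Type w where
  base : P.base ⟶ Q.base
  map : ∀ {a a' : A} (α : a ⟶ a') [g.IsHomLift base α],
    P.obj a (IsHomLift.domain_eq g base α) ⟶ Q.obj a' (IsHomLift.codomain_eq g base α)
  lift : ∀ {a a' : A} (α : a ⟶ a') [g.IsHomLift base α], f.IsHomLift α (map α)
  comp_map : ∀ {a a' a'' : A} (γ : a ⟶ a') (α : a' ⟶ a'') [g.IsHomLift (𝟙 P.base) γ]
    [g.IsHomLift base α], map (γ ≫ α) = P.map γ ≫ map α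
  map_comp : ∀ {a a' a'' : A} (α : a ⟶ a') (γ : a' ⟶ a'') [g.IsHomLift base α]
    [g.IsHomLift (𝟙 Q.base) γ], map (α ≫ γ) = map α ≫ Q.map γ

namespace PiHom

variable {P Q R : PiObj hg f}

theorem ext {m n : PiHom P Q} (h₁ : m.base = n.base)
    (h₂ : ∀ {a a' : A} (α : a ⟶ a') [g.IsHomLift m.base α] [g.IsHomLift n.base α],
      m.map α = n.map α) : m = n := by
  obtain ⟨b, t, l, h, h'⟩ := m
  obtain ⟨b₁, t₁, l₁, k, k'⟩ := n
  obtain rfl : b = b₁ := h₁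
  have : @t = @t₁ := by
    funext a a' α i
    exact h₂ α
  obtain rfl := this
  rfl

theorem map_congr (m : PiHom P Q) {a a' : A} {α β : a ⟶ a'} (h : α = β) [g.IsHomLift m.base α]
    [g.IsHomLift m.base β] : m.map α = m.map β := by
  subst h
  rfl

/-- The composition of two morphisms, evaluated at a composite. -/
theorem map_comp_map_eq (m : PiHom P Q) (n : PiHom Q R) {a a₁ a₂ a' : A} (φ : a ⟶ a₁)
    (φ' : a₁ ⟶ a') (ψ : a ⟶ a₂) (ψ' : a₂ ⟶ a') [g.IsHomLift m.base φ] [g.IsHomLift n.base φ']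
    [g.IsHomLift m.base ψ] [g.IsHomLift n.base ψ'] (h : φ ≫ φ' = ψ ≫ ψ') :
    m.map φ ≫ n.map φ' = m.map ψ ≫ n.map ψ' := by
  -- Two splittings of one arrow differ by the vertical arrow `inv φ ≫ ψ`, and the compatibility of
  -- `m` and `n` with vertical arrows moves it from one factor to the other.
  have i₁ : g.IsHomLift (𝟙 Q.base) (inv φ ≫ ψ) := by
    have : g.IsHomLift (inv m.base ≫ m.base) (inv φ ≫ ψ) := inferInstance
    rwa [IsIso.inv_hom_id] at this
  have h₁ : φ' = (inv φ ≫ ψ) ≫ ψ' := by simp [← h]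
  have h₂ : ψ = φ ≫ (inv φ ≫ ψ) := by simp
  rw [n.map_congr h₁, n.comp_map, m.map_congr h₂, m.map_comp, Category.assoc]

/-- Since `g` is a fibration, an arrow over a composite splits over its two factors. Composition of
morphisms of sections is defined through such splittings. -/
theorem exists_factor (m : PiHom P Q) {S : B} (k : Q.base ⟶ S) {a a' : A} (α : a ⟶ a')
    (hα : g.IsHomLift (m.base ≫ k) α) :
    ∃ (a₁ : A) (φ : a ⟶ a₁) (ψ : a₁ ⟶ a'), g.IsHomLift m.base φ ∧ g.IsHomLift k ψ ∧
      φ ≫ ψ = α := by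
  obtain ⟨a₁, φ, hφ⟩ := hg.exists_lift m.base a (IsHomLift.domain_eq g (m.base ≫ k) α)
  refine ⟨a₁, φ, inv φ ≫ α, hφ, ?_, by simp⟩
  have : g.IsHomLift (inv m.base ≫ m.base ≫ k) (inv φ ≫ α) := inferInstance
  rwa [IsIso.inv_hom_id_assoc] at this

/-- The value does not depend on the splitting. Quantifying over all splittings lets `compMap_eq` be
applied later to whichever one is convenient. -/
theorem exists_comp_map (m : PiHom P Q) (n : PiHom Q R) {a a' : A} (α : a ⟶ a')
    [hα : g.IsHomLift (m.base ≫ n.base) α] :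
    ∃ t : P.obj a (IsHomLift.domain_eq g (m.base ≫ n.base) α) ⟶
        R.obj a' (IsHomLift.codomain_eq g (m.base ≫ n.base) α),
      ∀ {a₁ : A} (φ : a ⟶ a₁) (ψ : a₁ ⟶ a') [g.IsHomLift m.base φ] [g.IsHomLift n.base ψ],
        φ ≫ ψ = α → t = m.map φ ≫ n.map ψ := by
  obtain ⟨a₁, φ, ψ, _, _, rfl⟩ := m.exists_factor n.base α hα
  exact ⟨m.map φ ≫ n.map ψ, fun φ' ψ' _ _ h => m.map_comp_map_eq n _ _ _ _ h.symm⟩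

/-- The identity. -/
def id (P : PiObj hg f) : PiHom P P where
  base := 𝟙 _
  map α := P.map α
  lift α := P.lift α
  comp_map γ α := P.map_comp γ α
  map_comp γ α := P.map_comp γ α

/-- The action of a composite on morphisms. -/
noncomputable def compMap (m : PiHom P Q) (n : PiHom Q R) {a a' : A} (α : a ⟶ a')
    [g.IsHomLift (m.base ≫ n.base) α] :
    P.obj a (IsHomLift.domain_eq g (m.base ≫ n.base) α) ⟶
      R.obj a' (IsHomLift.codomain_eq g (m.base ≫ n.base) α) :=
  (m.exists_comp_map n α).choose

theorem compMap_eq (m : PiHom P Q) (n : PiHom Q R) {a a₁ a' : A} (φ : a ⟶ a₁) (ψ : a₁ ⟶ a')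
    [g.IsHomLift m.base φ] [g.IsHomLift n.base ψ] :
    m.compMap n (φ ≫ ψ) = m.map φ ≫ n.map ψ :=
  (m.exists_comp_map n (φ ≫ ψ)).choose_spec φ ψ rfl

theorem compMap_congr (m : PiHom P Q) (n : PiHom Q R) {a a' : A} {α β : a ⟶ a'} (h : α = β)
    [g.IsHomLift (m.base ≫ n.base) α] [g.IsHomLift (m.base ≫ n.base) β] :
    m.compMap n α = m.compMap n β := by
  subst h
  rfl

/-- The composition. -/
noncomputable def comp (m : PiHom P Q) (n : PiHom Q R) : PiHom P R where
  base := m.base ≫ n.base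
  map α := m.compMap n α
  lift {a a'} α hα := by
    obtain ⟨a₁, φ, ψ, _, _, rfl⟩ := m.exists_factor n.base α hα
    rw [compMap_eq]
    have := m.lift φ
    have := n.lift ψ
    infer_instance
  comp_map {a a' a''} γ α hγ hα := by
    obtain ⟨a₁, φ, ψ, _, _, rfl⟩ := m.exists_factor n.base α hα
    rw [m.compMap_congr n (Category.assoc γ φ ψ).symm, compMap_eq, compMap_eq, m.comp_map,
      Category.assoc]
  map_comp {a a' a''} α γ hα hγ := by
    obtain ⟨a₁, φ, ψ, _, _, rfl⟩ := m.exists_factor n.base α hα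
    rw [m.compMap_congr n (Category.assoc φ ψ γ), compMap_eq, compMap_eq, n.map_comp]
    exact (Category.assoc _ _ _).symm

instance isHomLift_inv_of_inv (m : PiHom P Q) {a a' : A} (α : a ⟶ a') [g.IsHomLift (inv m.base) α] :
    g.IsHomLift m.base (inv α) := by
  have : g.IsHomLift (inv (inv m.base)) (inv α) := inferInstance
  rwa [IsIso.inv_inv] at this

/-- The inverse. -/
noncomputable def inverse (m : PiHom P Q) : PiHom Q P where
  base := inv m.base
  map α := inv (m.map (inv α))
  lift α _ := by
    have := m.lift (inv α)
    have h : f.IsHomLift (inv (inv α)) (inv (m.map (inv α))) := inferInstance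
    rwa [IsIso.inv_inv] at h
  comp_map γ α _ _ := by
    have h₁ : m.map (inv α) = m.map (inv (γ ≫ α)) ≫ Q.map γ := by
      rw [← m.map_comp]
      exact m.map_congr (by simp)
    rw [h₁, IsIso.eq_comp_inv]
    exact IsIso.inv_hom_id_assoc _ _
  map_comp α γ _ _ := by
    have h₁ : m.map (inv α) = P.map γ ≫ m.map (inv (α ≫ γ)) := by
      rw [← m.comp_map]
      exact m.map_congr (by simp)
    rw [h₁, IsIso.eq_inv_comp, Category.assoc]
    exact (congrArg (_ ≫ ·) (IsIso.hom_inv_id _)).trans (Category.comp_id _)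

end PiHom

noncomputable instance PiObj.groupoid : Groupoid.{w} (PiObj hg f) where
  Hom := PiHom
  id := PiHom.id
  comp := PiHom.comp
  id_comp {P Q} m := PiHom.ext (Category.id_comp _) fun {a a'} α h h' => by
    have i₁ : g.IsHomLift ((PiHom.id P).base ≫ m.base) α := h
    have i₂ : g.IsHomLift m.base α := h'
    change (PiHom.id P).compMap m α = m.map α
    have : g.IsHomLift (PiHom.id P).base (𝟙 a) := IsHomLift.id (IsHomLift.domain_eq g m.base α)
    rw [(PiHom.id P).compMap_congr m (Category.id_comp α).symm, PiHom.compMap_eq]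
    have i₃ : g.IsHomLift (𝟙 P.base) (𝟙 a) := this
    exact (congrArg (· ≫ m.map α) (P.map_id a)).trans (Category.id_comp _)
  comp_id {P Q} m := PiHom.ext (Category.comp_id _) fun {a a'} α h h' => by
    have i₁ : g.IsHomLift (m.base ≫ (PiHom.id Q).base) α := h
    have i₂ : g.IsHomLift m.base α := h'
    change m.compMap (PiHom.id Q) α = m.map α
    have : g.IsHomLift (PiHom.id Q).base (𝟙 a') :=
      IsHomLift.id (IsHomLift.codomain_eq g m.base α)
    rw [m.compMap_congr (PiHom.id Q) (Category.comp_id α).symm, PiHom.compMap_eq]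
    have i₃ : g.IsHomLift (𝟙 Q.base) (𝟙 a') := this
    exact (congrArg (m.map α ≫ ·) (Q.map_id a')).trans (Category.comp_id _)
  assoc {P Q R S} m n k := PiHom.ext (Category.assoc _ _ _) fun {a a'} α h' h => by
    have j₁ : g.IsHomLift ((m.comp n).base ≫ k.base) α := h'
    have j₂ : g.IsHomLift (m.base ≫ (n.comp k).base) α := h
    change (m.comp n).compMap k α = m.compMap (n.comp k) α
    obtain ⟨a₁, φ, ψ, _, hψ, rfl⟩ := m.exists_factor (n.base ≫ k.base) α h
    obtain ⟨a₂, φ', ψ', _, _, rfl⟩ := n.exists_factor k.base ψ hψ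
    have i₁ : g.IsHomLift (m.comp n).base (φ ≫ φ') :=
      inferInstanceAs (g.IsHomLift (m.base ≫ n.base) (φ ≫ φ'))
    have i₂ : g.IsHomLift (n.comp k).base (φ' ≫ ψ') :=
      inferInstanceAs (g.IsHomLift (n.base ≫ k.base) (φ' ≫ ψ'))
    rw [(m.comp n).compMap_congr k (Category.assoc φ φ' ψ').symm, PiHom.compMap_eq,
      PiHom.compMap_eq]
    change m.compMap n (φ ≫ φ') ≫ _ = _ ≫ n.compMap k (φ' ≫ ψ')
    rw [PiHom.compMap_eq, PiHom.compMap_eq, Category.assoc]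
  inv := PiHom.inverse
  inv_comp {P Q} m := PiHom.ext (IsIso.inv_hom_id _) fun {a a'} α h h' => by
    have i₁ : g.IsHomLift (m.inverse.base ≫ m.base) α := h
    have i₂ : g.IsHomLift (𝟙 Q.base) α := h'
    change m.inverse.compMap m α = Q.map α
    obtain ⟨a₁, φ, ψ, hφ, hψ, rfl⟩ := m.inverse.exists_factor m.base α h
    have i₃ : g.IsHomLift (inv m.base) φ := hφ
    rw [PiHom.compMap_eq]
    change inv (m.map (inv φ)) ≫ _ = _
    rw [IsIso.inv_comp_eq, ← m.map_comp]
    exact m.map_congr (by simp)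
  comp_inv {P Q} m := PiHom.ext (IsIso.hom_inv_id _) fun {a a'} α h h' => by
    have i₁ : g.IsHomLift (m.base ≫ m.inverse.base) α := h
    have i₂ : g.IsHomLift (𝟙 P.base) α := h'
    change m.compMap m.inverse α = P.map α
    obtain ⟨a₁, φ, ψ, _, hψ, rfl⟩ := m.exists_factor m.inverse.base α h
    have i₃ : g.IsHomLift (inv m.base) ψ := hψ
    rw [PiHom.compMap_eq]
    change _ ≫ inv (m.map (inv ψ)) = _
    rw [IsIso.comp_inv_eq, ← m.comp_map]
    exact m.map_congr (by simp)

end DependentProduct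

/-! ### Evaluation and currying for dependent products of groupoids -/

section DependentProductUniversal

variable {X A B H : Type w} [Groupoid.{w} X] [Groupoid.{w} A] [Groupoid.{w} B] [Groupoid.{w} H]
  {g : A ⥤ B} {hg : IsGroupoidFibration g} {f : X ⥤ A}

theorem PiObj.ext_of_heq {P Q : PiObj hg f} (h : P.base = Q.base)
    (h₁ : ∀ (a : A) (e : g.obj a = P.base) (e' : g.obj a = Q.base), P.obj a e = Q.obj a e')
    (h₂ : ∀ {a a' : A} (α : a ⟶ a') [g.IsHomLift (𝟙 P.base) α] [g.IsHomLift (𝟙 Q.base) α],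
      P.map α ≍ Q.map α) : P = Q := by
  obtain ⟨b, o, t, l, k, k'⟩ := P
  obtain ⟨b', o', t', l', j, j'⟩ := Q
  obtain rfl : b = b' := h
  have ho : o = o' := by
    funext a e
    exact h₁ a e e
  subst ho
  have ht : @t = @t' := by
    funext a a' α i
    exact eq_of_heq (h₂ α)
  subst ht
  rfl

/-- The section equation on objects is not a field of `PiObj`; it is read off from the lift of an
identity arrow. -/
theorem PiObj.obj_over (P : PiObj hg f) (a : A) (h : g.obj a = P.base) :
    f.obj (P.obj a h) = a := by
  have : g.IsHomLift (𝟙 P.base) (𝟙 a) := IsHomLift.id h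
  have := P.lift (𝟙 a)
  exact IsHomLift.domain_eq f (𝟙 a) (P.map (𝟙 a))

theorem PiHom.hext {P Q P' Q' : PiObj hg f} (hP : P = P') (hQ : Q = Q') {m : PiHom P Q}
    {n : PiHom P' Q'} (h₁ : m.base ≍ n.base)
    (h₂ : ∀ {a a' : A} (α : a ⟶ a') [g.IsHomLift m.base α] [g.IsHomLift n.base α],
      m.map α ≍ n.map α) : m ≍ n := by
  subst hP hQ
  exact heq_of_eq (PiHom.ext (eq_of_heq h₁) fun α _ _ => eq_of_heq (h₂ α))

namespace PiObj

variable (hg f) in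
/-- The projection of the dependent product. -/
noncomputable def proj : PiObj hg f ⥤ B where
  obj P := P.base
  map m := PiHom.base m
  map_id _ := rfl
  map_comp _ _ := rfl

variable (hg f) in
/-- Evaluation of sections. -/
noncomputable def eval : StrictPullback (proj hg f) g ⥤ X where
  obj z := z.fst.obj z.snd z.w
  map m := @PiHom.map _ _ _ _ _ _ _ _ _ _ _ (StrictPullback.Hom.fst m) _ _
    (StrictPullback.Hom.snd m) (StrictPullback.Hom.w m)
  map_id z := by
    have : g.IsHomLift (𝟙 z.fst.base) (𝟙 z.snd) := IsHomLift.id z.w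
    exact z.fst.map_id z.snd
  map_comp m n := by
    have := StrictPullback.Hom.w m
    have := StrictPullback.Hom.w n
    exact @PiHom.compMap_eq _ _ _ _ _ _ _ _ _ _ _ _ (StrictPullback.Hom.fst m)
      (StrictPullback.Hom.fst n) _ _ _ (StrictPullback.Hom.snd m) (StrictPullback.Hom.snd n)
      (StrictPullback.Hom.w m) (StrictPullback.Hom.w n)

variable (hg f) in
theorem eval_comp : eval hg f ⋙ f = StrictPullback.sndFunctor (proj hg f) g :=
  comp_eq_of_isHomLift fun {_ _} m => @PiHom.lift _ _ _ _ _ _ _ _ _ _ _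
    (StrictPullback.Hom.fst m) _ _ (StrictPullback.Hom.snd m) (StrictPullback.Hom.w m)

/-- Evaluation of a family of sections indexed by `H`. -/
noncomputable def uncurry (m : H ⥤ PiObj hg f) : StrictPullback (m ⋙ proj hg f) g ⥤ X :=
  StrictPullback.lift (h := proj hg f)
    (StrictPullback.fstFunctor (m ⋙ proj hg f) g ⋙ m)
    (StrictPullback.sndFunctor (m ⋙ proj hg f) g)
    (StrictPullback.condition (m ⋙ proj hg f) g) ⋙ eval hg f

theorem isHomLift_map_of_comp_eq_snd {h : H ⥤ B} {k : StrictPullback h g ⥤ X}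
    (hk : k ⋙ f = StrictPullback.sndFunctor h g) {z z' : StrictPullback h g} (n : z ⟶ z') :
    f.IsHomLift (StrictPullback.Hom.snd n) (k.map n) :=
  isHomLift_of_comp_eq hk n

variable {h : H ⥤ B} (k : StrictPullback h g ⥤ X)
  (hk : k ⋙ f = StrictPullback.sndFunctor h g)

/-- The section determined by a functor on the pullback. -/
noncomputable def curryObj (y : H) : PiObj hg f where
  base := h.obj y
  obj a e := k.obj ⟨y, a, e⟩
  map α i := k.map (StrictPullback.homMk (𝟙 y) α (by rwa [h.map_id]))
  lift α i := isHomLift_map_of_comp_eq_snd hk (StrictPullback.homMk (𝟙 y) α (by rwa [h.map_id]))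
  map_id _ _ := k.map_id _
  map_comp α α' _ _ := by
    rw [← k.map_comp]
    exact congrArg k.map (StrictPullback.Hom.ext (Category.comp_id _).symm rfl)

/-- The morphism of sections determined by a functor on the pullback. -/
noncomputable def curryMap {y y' : H} (η : y ⟶ y') :
    PiHom (hg := hg) (curryObj k hk y) (curryObj k hk y') where
  base := h.map η
  map α i := k.map (StrictPullback.homMk η α i)
  lift α i := isHomLift_map_of_comp_eq_snd hk (StrictPullback.homMk η α i)
  comp_map γ α _ _ := by
    refine Eq.trans ?_ (k.map_comp _ _)
    exact congrArg k.map (StrictPullback.Hom.ext (Category.id_comp _).symm rfl)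
  map_comp γ α _ _ := by
    refine Eq.trans ?_ (k.map_comp _ _)
    exact congrArg k.map (StrictPullback.Hom.ext (Category.comp_id _).symm rfl)

/-- The functor to the dependent product determined by a functor on the pullback. -/
noncomputable def curry : H ⥤ PiObj hg f where
  obj y := curryObj k hk y
  map η := curryMap k hk η
  map_id y := PiHom.ext (h.map_id y) fun _ _ _ => rfl
  map_comp {y₁ y₂ y₃} η η' := PiHom.ext (h.map_comp η η') fun {a a'} α i₁ i₂ => by
    obtain ⟨a₁, φ, ψ, j₁, j₂, rfl⟩ := (curryMap (hg := hg) k hk η).exists_factor (h.map η') α i₂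
    have j₃ : g.IsHomLift (curryMap (hg := hg) k hk η').base ψ := j₂
    refine Eq.trans ?_ ((curryMap k hk η).compMap_eq (curryMap k hk η') φ ψ).symm
    exact k.map_comp (StrictPullback.homMk η φ j₁) (StrictPullback.homMk η' ψ j₂)

/-- Recovers the action of a section on vertical arrows from the value of a functor at an identity,
which is an identity only up to a propositional equality. -/
theorem map_eq_of_eq_id {P : PiObj hg f} (m : P ⟶ P) (hm : m = 𝟙 P) {a a' : A} (α : a ⟶ a')
    [g.IsHomLift (PiHom.base m) α] [g.IsHomLift (𝟙 P.base) α] :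
    PiHom.map m α = P.map α := by
  subst hm
  rfl

/-- Uniqueness in the universal property. Evaluation at `(y, a)` determines the section at `y` on
objects, evaluation at `(𝟙 y, α)` determines it on vertical arrows, and evaluation at `(η, α)`
determines the functor on morphisms. -/
theorem eq_of_uncurry_heq {m m' : H ⥤ PiObj hg f} (e : m' ⋙ proj hg f = m ⋙ proj hg f)
    (h : StrictPullback.lift (h := proj hg f)
      (StrictPullback.fstFunctor (m ⋙ proj hg f) g ⋙ m')
      (StrictPullback.sndFunctor (m ⋙ proj hg f) g)
      ((congrArg (StrictPullback.fstFunctor (m ⋙ proj hg f) g ⋙ ·) e).trans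
        (StrictPullback.condition (m ⋙ proj hg f) g)) ⋙ eval hg f = uncurry m) : m' = m := by
  have hobj : ∀ y, m'.obj y = m.obj y := fun y => by
    refine PiObj.ext_of_heq (Functor.congr_obj e y) (fun a _ e₂ => ?_) ?_
    · exact Functor.congr_obj h ⟨y, a, e₂⟩
    · intro a a' α i₁ i₂
      have i₃ : g.IsHomLift (PiHom.base (m'.map (𝟙 y))) α := by
        rw [m'.map_id]
        exact i₁
      have i₄ : g.IsHomLift (PiHom.base (m.map (𝟙 y))) α := by
        rw [m.map_id]
        exact i₂
      rw [← map_eq_of_eq_id (m'.map (𝟙 y)) (m'.map_id y) α,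
        ← map_eq_of_eq_id (m.map (𝟙 y)) (m.map_id y) α]
      exact Functor.hcongr_hom h (StrictPullback.homMk (𝟙 y) α i₄)
  refine Functor.hext hobj fun y y' η => ?_
  refine PiHom.hext (hobj y) (hobj y') (Functor.hcongr_hom e η) ?_
  intro a a' α i₁ i₂
  exact Functor.hcongr_hom h (StrictPullback.homMk (η) α i₂)

end PiObj

end DependentProductUniversal

/-! ### Fibration properties and fibre cardinalities of dependent products -/

section DependentProductFibration

/-- A dependent function is determined by its graph, a subset of the sigma type. The latter has
cardinality below `c` by regularity, and so does its power set by the strong limit property. -/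
theorem Cardinal.IsInaccessible.mk_pi_lt {c : Cardinal.{w}} (hc : c.IsInaccessible)
    {ι : Type w} {F : ι → Type w} (hι : #ι < c) (hF : ∀ i, #(F i) < c) : #(∀ i, F i) < c := by
  have h₁ : #(Σ i, F i) < c := by
    rw [Cardinal.mk_sigma]
    exact Cardinal.sum_lt_of_isRegular hc.isRegular hι hF
  refine lt_of_le_of_lt (Cardinal.mk_le_of_injective (β := Set (Σ i, F i))
    (f := fun s => Set.range fun i => (⟨i, s i⟩ : Σ i, F i)) ?_) ?_
  · intro s t h
    funext i
    have hi : (⟨i, s i⟩ : Σ i, F i) ∈ Set.range fun i => (⟨i, t i⟩ : Σ i, F i) := by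
      rw [← show (Set.range fun i => (⟨i, s i⟩ : Σ i, F i)) =
        Set.range fun i => (⟨i, t i⟩ : Σ i, F i) from h]
      exact ⟨i, rfl⟩
    obtain ⟨j, hj⟩ := hi
    obtain ⟨rfl, h'⟩ := Sigma.mk.inj_iff.1 hj
    exact (eq_of_heq h').symm
  · rw [Cardinal.mk_set]
    exact hc.isStrongLimit.isStrongPrelimit h₁

variable {X A B : Type w} [Groupoid.{w} X] [Groupoid.{w} A] [Groupoid.{w} B]
  {g : A ⥤ B} {hg : IsGroupoidFibration g} {f : X ⥤ A}

theorem IsDiscreteGroupoidFibration.lift_heq {F : A ⥤ B} (hF : IsDiscreteGroupoidFibration F)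
    {R S : B} (φ : R ⟶ S) {a₁ a₁' a₂ a₂' : A} (h : a₁ = a₂) (ψ₁ : a₁ ⟶ a₁') (ψ₂ : a₂ ⟶ a₂')
    (h₁ : F.IsHomLift φ ψ₁) (h₂ : F.IsHomLift φ ψ₂) : ψ₁ ≍ ψ₂ := by
  subst h
  exact (hF.lift_unique φ ψ₁ ψ₂ h₁ h₂).2

namespace PiObj

/-- The value at `a'` of a section transported along `β`: go back along a lift of `β` ending at
`a'`, evaluate `P`, and return along a lift by `f`. -/
theorem exists_transport (hf : IsGroupoidFibration f) (P : PiObj hg f) {b : B}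
    (β : P.base ⟶ b) (a' : A) (h : g.obj a' = b) :
    ∃ (a : A) (ψ : a ⟶ a') (_ : g.IsHomLift β ψ) (x : X)
      (ξ : P.obj a (IsHomLift.domain_eq g β ψ) ⟶ x), f.IsHomLift ψ ξ := by
  obtain ⟨a, ψ, i⟩ := hg.exists_lift_to β a' h
  obtain ⟨x, ξ, hξ⟩ := hf.exists_lift ψ (P.obj a (IsHomLift.domain_eq g β ψ)) (P.obj_over _ _)
  exact ⟨a, ψ, i, x, ξ, hξ⟩

theorem map_congr (P : PiObj hg f) {a a' : A} {α β : a ⟶ a'} (h : α = β)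
    [g.IsHomLift (𝟙 P.base) α] [g.IsHomLift (𝟙 P.base) β] : P.map α = P.map β := by
  subst h
  rfl

/-- The chosen lifts `ψ` and `ξ` need not be functorial. The transported section acts on vertical
arrows by conjugation with them, so they cancel in composites. -/
theorem isGroupoidFibration_proj (hf : IsGroupoidFibration f) :
    IsGroupoidFibration (proj hg f) := by
  intro P b β
  change P.base ⟶ b at β
  choose c ψ i x ξ hξ using P.exists_transport hf β
  have j₁ : ∀ {a a' : A} (γ : a ⟶ a') (h : g.obj a = b) (h' : g.obj a' = b)
      [g.IsHomLift (𝟙 b) γ], g.IsHomLift (𝟙 P.base) (ψ a h ≫ γ ≫ inv (ψ a' h')) := by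
    intro a a' γ h h' _
    have := i a h
    have := i a' h'
    have : g.IsHomLift (β ≫ 𝟙 b ≫ inv β) (ψ a h ≫ γ ≫ inv (ψ a' h')) := inferInstance
    rwa [Category.id_comp, IsIso.hom_inv_id] at this
  -- An arrow over `β` differs from the chosen lift `ψ` by a vertical arrow over `P.base`, on which
  -- `P` is defined; this gives the morphism from `P` to its transport.
  have j₂ : ∀ {a a' : A} (α : a ⟶ a') (h' : g.obj a' = b) [g.IsHomLift β α],
      g.IsHomLift (𝟙 P.base) (α ≫ inv (ψ a' h')) := by
    intro a a' α h' _
    have := i a' h'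
    have : g.IsHomLift (β ≫ inv β) (α ≫ inv (ψ a' h')) := inferInstance
    rwa [IsIso.hom_inv_id] at this
  let Q : PiObj hg f :=
    { base := b
      obj := x
      map := fun {a a'} γ _ =>
        inv (ξ a (IsHomLift.domain_eq g (𝟙 b) γ)) ≫
          @PiObj.map _ _ _ _ _ _ _ _ _ P _ _ (ψ a (IsHomLift.domain_eq g (𝟙 b) γ) ≫ γ ≫
            inv (ψ a' (IsHomLift.codomain_eq g (𝟙 b) γ))) (j₁ γ _ _) ≫
            ξ a' (IsHomLift.codomain_eq g (𝟙 b) γ)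
      lift := fun {a a'} γ _ => by
        have h := IsHomLift.domain_eq g (𝟙 b) γ
        have h' := IsHomLift.codomain_eq g (𝟙 b) γ
        have := hξ a h
        have := hξ a' h'
        have := j₁ γ h h'
        have := P.lift (ψ a h ≫ γ ≫ inv (ψ a' h'))
        have k : f.IsHomLift (inv (ψ a h) ≫ (ψ a h ≫ γ ≫ inv (ψ a' h')) ≫ ψ a' h')
          (inv (ξ a h) ≫ P.map (ψ a h ≫ γ ≫ inv (ψ a' h')) ≫ ξ a' h') := inferInstance
        have e : inv (ψ a h) ≫ (ψ a h ≫ γ ≫ inv (ψ a' h')) ≫ ψ a' h' = γ := by simp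
        rwa [e] at k
      map_id := fun a _ => by
        have h := IsHomLift.domain_eq g (𝟙 b) (𝟙 a)
        have := j₁ (𝟙 a) h h
        have : g.IsHomLift (𝟙 P.base) (𝟙 (c a h)) := IsHomLift.id
          (have := i a h; IsHomLift.domain_eq g β (ψ a h))
        have e : ψ a h ≫ 𝟙 a ≫ inv (ψ a h) = 𝟙 _ := by simp
        rw [P.map_congr e, P.map_id]
        simp
      map_comp := fun {a a' a''} γ γ' _ _ => by
        have h := IsHomLift.domain_eq g (𝟙 b) γ
        have h' := IsHomLift.codomain_eq g (𝟙 b) γ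
        have h'' := IsHomLift.codomain_eq g (𝟙 b) γ'
        have := j₁ γ h h'
        have := j₁ γ' h' h''
        have := j₁ (γ ≫ γ') h h''
        have e : ψ a h ≫ (γ ≫ γ') ≫ inv (ψ a'' h'') =
          (ψ a h ≫ γ ≫ inv (ψ a' h')) ≫ (ψ a' h' ≫ γ' ≫ inv (ψ a'' h'')) := by simp
        rw [P.map_congr e, P.map_comp]
        simp }
  let m : PiHom P Q :=
    { base := β
      map := fun {a a'} α _ =>
        @PiObj.map _ _ _ _ _ _ _ _ _ P _ _ (α ≫ inv (ψ a' (IsHomLift.codomain_eq g β α)))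
          (j₂ α _) ≫ ξ a' (IsHomLift.codomain_eq g β α)
      lift := fun {a a'} α _ => by
        have h' := IsHomLift.codomain_eq g β α
        have := hξ a' h'
        have := j₂ α h'
        have := P.lift (α ≫ inv (ψ a' h'))
        have k : f.IsHomLift ((α ≫ inv (ψ a' h')) ≫ ψ a' h')
          (P.map (α ≫ inv (ψ a' h')) ≫ ξ a' h') := inferInstance
        have e : (α ≫ inv (ψ a' h')) ≫ ψ a' h' = α := by simp
        rwa [e] at k
      comp_map := fun {a a' a''} γ α _ _ => by
        have h'' := IsHomLift.codomain_eq g β α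
        have := j₂ α h''
        have := j₂ (γ ≫ α) h''
        rw [P.map_congr (Category.assoc γ α (inv (ψ a'' h''))), P.map_comp, Category.assoc]
      map_comp := fun {a a' a''} α γ _ i' => by
        have i'' : g.IsHomLift (𝟙 b) γ := i'
        have h' := IsHomLift.codomain_eq g β α
        have h'' := IsHomLift.codomain_eq g (𝟙 b) γ
        have := j₂ α h'
        have : g.IsHomLift β (α ≫ γ) := inferInstance
        have := j₂ (α ≫ γ) h''
        have := j₁ γ h' h''
        have e : (α ≫ γ) ≫ inv (ψ a'' h'') =
          (α ≫ inv (ψ a' h')) ≫ (ψ a' h' ≫ γ ≫ inv (ψ a'' h'')) := by simp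
        rw [P.map_congr e, P.map_comp]
        change _ = (_ ≫ _) ≫ inv (ξ a' _) ≫ _ ≫ ξ a'' _
        simp }
  have hm : (proj hg f).IsHomLift ((proj hg f).map (X := P) (Y := Q) m) m :=
    .map (a := P) (b := Q) m
  exact ⟨Q, m, hm⟩

/-- For each `α` over the common base arrow, both morphisms give lifts of `α` along the discrete
fibration `f` from the same object, so they agree. Every object over `Q₁.base` is the codomain of
such an `α`, so the targets agree too. -/
theorem eq_of_base_heq (hf : IsDiscreteGroupoidFibration f) {P Q₁ Q₂ : PiObj hg f}
    (m₁ : PiHom P Q₁) (m₂ : PiHom P Q₂) (hb : Q₁.base = Q₂.base) (hm : m₁.base ≍ m₂.base) :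
    Q₁ = Q₂ ∧ m₁ ≍ m₂ := by
  have key : ∀ {a a' : A} (α : a ⟶ a') (_ : g.IsHomLift m₁.base α) (_ : g.IsHomLift m₂.base α),
      Q₁.obj a' (IsHomLift.codomain_eq g m₁.base α) =
        Q₂.obj a' (IsHomLift.codomain_eq g m₂.base α) ∧ m₁.map α ≍ m₂.map α :=
    fun α _ _ => hf.lift_unique α (m₁.map α) (m₂.map α) (m₁.lift α) (m₂.lift α)
  have hobj : ∀ (a : A) (e : g.obj a = Q₁.base) (e' : g.obj a = Q₂.base),
      Q₁.obj a e = Q₂.obj a e' := fun a e _ => by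
    obtain ⟨_, α, h⟩ := hg.exists_lift_to m₁.base a e
    exact (key α h (isHomLift_of_heq hb hm h)).1
  have hQ : Q₁ = Q₂ := PiObj.ext_of_heq hb hobj fun α _ _ =>
    hf.lift_heq α (hobj _ _ _) _ _ (Q₁.lift α) (Q₂.lift α)
  exact ⟨hQ, PiHom.hext rfl hQ hm fun α h h' => (key α h h').2⟩

theorem isDiscreteGroupoidFibration_proj (hf : IsDiscreteGroupoidFibration f) :
    IsDiscreteGroupoidFibration (proj hg f) := by
  refine isDiscreteGroupoidFibration_of_exists_of_unique (isGroupoidFibration_proj hf.1) ?_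
  intro P b β Q₁ Q₂ m₁ m₂ h₁ h₂
  exact eq_of_base_heq hf m₁ m₂
    ((IsHomLift.codomain_eq (proj hg f) β m₁).trans (IsHomLift.codomain_eq (proj hg f) β m₂).symm)
    ((map_heq_of_isHomLift h₁).trans (map_heq_of_isHomLift h₂).symm)

/-- As `f` is discrete, a section is determined by its values on objects, so the fibre over `b`
embeds in the product of the fibres of `f` indexed by the fibre of `g` over `b`. -/
theorem isSmallDiscreteFibration_proj {c : Cardinal.{w}} (hc : c.IsInaccessible)
    (hgs : IsSmallDiscreteFibration c g) (hf : IsSmallDiscreteFibration c f) :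
    IsSmallDiscreteFibration c (proj hg f) := by
  refine ⟨isDiscreteGroupoidFibration_proj hf.discrete, fun b => ?_⟩
  refine lt_of_le_of_lt (Cardinal.mk_le_of_injective (β := ∀ a : g.Fiber b, f.Fiber a.1)
    (f := fun P a => ⟨P.1.obj a.1 (a.2.trans P.2.symm), P.1.obj_over _ _⟩) ?_)
    (hc.mk_pi_lt (hgs.card_lt b) fun a => hf.card_lt a.1)
  intro P Q h
  refine Subtype.ext ?_
  have hobj : ∀ (a : A) (e : g.obj a = P.1.base) (e' : g.obj a = Q.1.base),
      P.1.obj a e = Q.1.obj a e' := fun a e e' =>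
    congrArg (fun z => z.1) (congrFun h ⟨a, e.trans P.2⟩)
  refine PiObj.ext_of_heq (P.2.trans Q.2.symm) hobj ?_
  intro a a' α _ _
  exact hf.discrete.lift_heq α (hobj _ _ _) _ _ (P.1.lift α) (Q.1.lift α)

end PiObj

end DependentProductFibration

/-! ## Universal sections -/

section UniversalSection

variable {C : Type u} [Category.{v} C]

/-- `ε : q ×_B g ⟶ f` exhibits `q` as the dependent product of `f` along `g`. -/
structure IsUniversalSection {X A B P W : C} (g : A ⟶ B) (f : X ⟶ A) (q : P ⟶ B) (w₁ : W ⟶ P)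
    (w₂ : W ⟶ A) (ε : W ⟶ X) : Prop where
  isPullback : IsPullback w₁ w₂ q g
  comp_eq : ε ≫ f = w₂
  existsUnique : ∀ {H V : C} (h : H ⟶ B) (v₁ : V ⟶ H) (v₂ : V ⟶ A), IsPullback v₁ v₂ h g →
    ∀ k : V ⟶ X, k ≫ f = v₂ → ∃! m : H ⟶ P, m ≫ q = h ∧
      ∀ l : V ⟶ W, l ≫ w₁ = v₁ ≫ m → l ≫ w₂ = v₂ → l ≫ ε = k

variable {X A B P W : C} {g : A ⟶ B} {f : X ⟶ A} {q : P ⟶ B} {w₁ : W ⟶ P} {w₂ : W ⟶ A}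
  {ε : W ⟶ X}

/-- Applied to the chosen pullbacks, the universal property says that pulling back along `g` and
composing with the counit `c` built from `ε` is bijective. -/
theorem IsUniversalSection.isDependentProduct (h : IsUniversalSection g f q w₁ w₂ ε)
    [HasPullbacksAlong g] : IsDependentProduct g f q := by
  let c : (Over.pullback g).obj (Over.mk q) ⟶ Over.mk f :=
    Over.homMk (h.isPullback.lift (pullback.fst q g) (pullback.snd q g) pullback.condition ≫ ε)
      (by simp [h.comp_eq])
  -- A map `l` with these two projections is the pullback of `m` followed by the comparison with
  -- `W`, so the transpose of `m` is `l ≫ ε`.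
  have hc : ∀ (Y : Over B) (m : Y ⟶ Over.mk q) (l : pullback Y.hom g ⟶ W),
      l ≫ w₁ = pullback.fst Y.hom g ≫ m.left → l ≫ w₂ = pullback.snd Y.hom g →
        ((Over.pullback g).map m ≫ c).left = l ≫ ε := by
    intro Y m l h₁ h₂
    have : l = ((Over.pullback g).map m).left ≫
        h.isPullback.lift (pullback.fst q g) (pullback.snd q g) pullback.condition := by
      apply h.isPullback.hom_ext
      · simpa [h₁] using (pullback.lift_fst _ _ _).symm
      · simpa [h₂] using (pullback.lift_snd _ _ _).symm
    simp [this, c]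
  have hl : ∀ (Y : Over B) (m : Y ⟶ Over.mk q), ∃ l : pullback Y.hom g ⟶ W,
      l ≫ w₁ = pullback.fst Y.hom g ≫ m.left ∧ l ≫ w₂ = pullback.snd Y.hom g := fun Y m =>
    ⟨h.isPullback.lift (pullback.fst Y.hom g ≫ m.left) (pullback.snd Y.hom g) (by
      have := Over.w m
      simp only [Over.mk_hom] at this
      rw [Category.assoc, this, pullback.condition]), by simp, by simp⟩
  have hb : ∀ Y : Over B, Function.Bijective
      fun m : Y ⟶ Over.mk q => (Over.pullback g).map m ≫ c := by
    intro Y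
    constructor
    · intro m m' e
      have hw : ((Over.pullback g).map m ≫ c).left ≫ f = pullback.snd Y.hom g :=
        Over.w ((Over.pullback g).map m ≫ c)
      have := (h.existsUnique Y.hom _ _ (IsPullback.of_hasPullback Y.hom g) _ hw).unique
        (y₁ := m.left) (y₂ := m'.left) ⟨Over.w m, fun l h₁ h₂ => (hc Y m l h₁ h₂).symm⟩
        ⟨Over.w m', fun l h₁ h₂ => by
          rw [← hc Y m' l h₁ h₂]
          exact congrArg (fun z => z.left) e.symm⟩
      exact Over.OverMorphism.ext this
    · intro k
      obtain ⟨m, ⟨hm₁, hm₂⟩, -⟩ := h.existsUnique Y.hom _ _ (IsPullback.of_hasPullback Y.hom g)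
        k.left (Over.w k)
      refine ⟨Over.homMk m hm₁, Over.OverMorphism.ext ?_⟩
      obtain ⟨l, h₁, h₂⟩ := hl Y (Over.homMk m hm₁)
      exact (hc Y _ l h₁ h₂).trans (hm₂ l h₁ h₂)
  exact ⟨{ homEquiv := fun {Y} => Equiv.ofBijective _ (hb Y)
           homEquiv_comp := fun m m' => by
             change (Over.pullback g).map (m ≫ m') ≫ c =
               (Over.pullback g).map m ≫ (Over.pullback g).map m' ≫ c
             rw [Functor.map_comp, Category.assoc] }⟩

theorem IsDependentProduct.exists_iso [HasPullbacksAlong g] {P' : C} {q' : P' ⟶ B}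
    (h : IsDependentProduct g f q) (h' : IsDependentProduct g f q') :
    ∃ e : P ≅ P', e.hom ≫ q' = q := by
  obtain ⟨r⟩ := h
  obtain ⟨r'⟩ := h'
  let e := r.uniqueUpToIso r'
  exact ⟨(Over.forget B).mapIso e, Over.w e.hom⟩

end UniversalSection

/-! ## Universal sections of objects with a group action -/

section Action

variable {C : Type u} [Category.{v} C] {G : Type w} [Group G]

theorem SingleObj.natTrans_ext {F F' : SingleObj G ⥤ C} {α β : F ⟶ F'}
    (h : α.app (SingleObj.star G) = β.app (SingleObj.star G)) : α = β :=
  NatTrans.ext (funext fun _ => h)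

/-- An object of the functor category, given by an action on an object. -/
def SingleObj.functorMk (X : C) (a : G → (X ⟶ X)) (h₁ : a 1 = 𝟙 X)
    (h₂ : ∀ s t : G, a (t * s) = a s ≫ a t) : SingleObj G ⥤ C where
  obj _ := X
  map s := a s
  map_id _ := h₁
  map_comp s t := h₂ s t

/-- A morphism of the functor category, given by an equivariant morphism. -/
def SingleObj.natTransMk {F F' : SingleObj G ⥤ C}
    (α : F.obj (SingleObj.star G) ⟶ F'.obj (SingleObj.star G))
    (h : ∀ s : SingleObj.star G ⟶ SingleObj.star G, F.map s ≫ α = α ≫ F'.map s) : F ⟶ F' where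
  app _ := α
  naturality _ _ s := h s

/-- The group acts on the universal section of the underlying objects by universality: acting on
`A`, `B` and `X` turns one section problem into another. The action laws and the equivariance of
transposes follow from uniqueness. -/
theorem exists_isUniversalSection_of_singleObj [HasPullbacks C] {X A B : SingleObj G ⥤ C}
    (g : A ⟶ B) (f : X ⟶ A) {P₀ W₀ : C} {q₀ : P₀ ⟶ B.obj (SingleObj.star G)} {w₁ : W₀ ⟶ P₀}
    {w₂ : W₀ ⟶ A.obj (SingleObj.star G)} {ε : W₀ ⟶ X.obj (SingleObj.star G)}
    (h₀ : IsUniversalSection (g.app (SingleObj.star G)) (f.app (SingleObj.star G)) q₀ w₁ w₂ ε) :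
    ∃ (P W : SingleObj G ⥤ C) (q : P ⟶ B) (w₁' : W ⟶ P) (w₂' : W ⟶ A) (ε' : W ⟶ X)
      (e : P.obj (SingleObj.star G) ≅ P₀), e.hom ≫ q₀ = q.app (SingleObj.star G) ∧
      IsUniversalSection g f q w₁' w₂' ε' := by
  -- A group element acts on `A` and `B` by isomorphisms, so it twists a pullback square over `g`
  -- into another one.
  have hpb : ∀ {H V : C} {h : H ⟶ B.obj (SingleObj.star G)} {v₁ : V ⟶ H}
      {v₂ : V ⟶ A.obj (SingleObj.star G)},
      IsPullback v₁ v₂ h (g.app (SingleObj.star G)) →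
      ∀ s : SingleObj.star G ⟶ SingleObj.star G,
        IsPullback v₁ (v₂ ≫ A.map s) (h ≫ B.map s) (g.app (SingleObj.star G)) := by
    intro H V h v₁ v₂ hp s
    exact hp.of_iso (Iso.refl _) (Iso.refl _) (asIso (A.map s)) (asIso (B.map s))
      (by simp) (by simp) (by simp) (by simp)
  -- `a s` classifies the section `ε ≫ X.map s` over the twisted square; `b s` below is the map it
  -- induces on `W₀`.
  have hex := fun s : SingleObj.star G ⟶ SingleObj.star G =>
    h₀.existsUnique (q₀ ≫ B.map s) w₁ (w₂ ≫ A.map s) (hpb h₀.isPullback s) (ε ≫ X.map s)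
      (by rw [Category.assoc, f.naturality, reassoc_of% h₀.comp_eq])
  choose a ha ha' using hex
  have hex' : ∀ s : SingleObj.star G ⟶ SingleObj.star G, ∃ l : W₀ ⟶ W₀,
      l ≫ w₁ = w₁ ≫ a s ∧ l ≫ w₂ = w₂ ≫ A.map s := fun s =>
    ⟨h₀.isPullback.lift (w₁ ≫ a s) (w₂ ≫ A.map s) (by
      rw [Category.assoc, (ha s).1, Category.assoc, g.naturality,
        reassoc_of% h₀.isPullback.w]), by simp, by simp⟩
  choose b hb₁ hb₂ using hex'
  have hb₃ : ∀ s, b s ≫ ε = ε ≫ X.map s := fun s => (ha s).2 (b s) (hb₁ s) (hb₂ s)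
  have ha₁ : a (𝟙 _) = 𝟙 _ := by
    refine (ha' (𝟙 _) (𝟙 _) ⟨by simp, fun l h₁ h₂ => ?_⟩).symm
    have : l = 𝟙 _ := h₀.isPullback.hom_ext (by simpa using h₁) (by simpa using h₂)
    simp [this]
  have ha₂ : ∀ s t, a (s ≫ t) = a s ≫ a t := by
    intro s t
    refine (ha' (s ≫ t) (a s ≫ a t) ⟨?_, fun l h₁ h₂ => ?_⟩).symm
    · rw [Category.assoc, (ha t).1, reassoc_of% (ha s).1, B.map_comp]
    · have : l = b s ≫ b t := by
        apply h₀.isPullback.hom_ext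
        · rw [h₁, Category.assoc, hb₁, reassoc_of% hb₁]
        · rw [h₂, Category.assoc, hb₂, reassoc_of% hb₂, A.map_comp]
      rw [this, Category.assoc, hb₃, reassoc_of% hb₃, X.map_comp]
  have hb₄ : b (𝟙 _) = 𝟙 _ := by
    apply h₀.isPullback.hom_ext
    · rw [hb₁, ha₁, Category.comp_id, Category.id_comp]
    · rw [hb₂, A.map_id, Category.comp_id, Category.id_comp]
  have hb₅ : ∀ s t, b (s ≫ t) = b s ≫ b t := by
    intro s t
    apply h₀.isPullback.hom_ext
    · rw [hb₁, ha₂, Category.assoc, hb₁, reassoc_of% hb₁]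
    · rw [hb₂, A.map_comp, Category.assoc, hb₂, reassoc_of% hb₂]
  let P : SingleObj G ⥤ C := SingleObj.functorMk P₀ a ha₁ ha₂
  let W : SingleObj G ⥤ C := SingleObj.functorMk W₀ b hb₄ hb₅
  let q : P ⟶ B := SingleObj.natTransMk q₀ fun s => (ha s).1
  let w₁' : W ⟶ P := SingleObj.natTransMk w₁ hb₁
  let w₂' : W ⟶ A := SingleObj.natTransMk w₂ hb₂
  let ε' : W ⟶ X := SingleObj.natTransMk ε hb₃
  have hW : IsPullback w₁' w₂' q g := .of_forall_isPullback_app fun _ => h₀.isPullback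
  refine ⟨P, W, q, w₁', w₂', ε', Iso.refl _, Category.id_comp _, hW,
    SingleObj.natTrans_ext h₀.comp_eq, ?_⟩
  intro H V h v₁ v₂ hp k hk
  have hp₀ := hp.app (SingleObj.star G)
  have hk₀ : k.app (SingleObj.star G) ≫ f.app (SingleObj.star G) = v₂.app _ :=
    NatTrans.congr_app hk _
  obtain ⟨m, ⟨hm₁, hm₂⟩, hm₃⟩ := h₀.existsUnique _ _ _ hp₀ (k.app _) hk₀
  obtain ⟨l, hl₁, hl₂⟩ : ∃ l : V.obj (SingleObj.star G) ⟶ W₀,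
      l ≫ w₁ = v₁.app _ ≫ m ∧ l ≫ w₂ = v₂.app _ :=
    ⟨h₀.isPullback.lift (v₁.app _ ≫ m) (v₂.app _) (by rw [Category.assoc, hm₁, hp₀.w]),
      by simp, by simp⟩
  -- Both composites classify the section `k ≫ X.map s` over the square twisted by `s`.
  have hnat : ∀ s : SingleObj.star G ⟶ SingleObj.star G, H.map s ≫ m = m ≫ a s := by
    intro s
    refine (h₀.existsUnique _ _ _ (hpb hp₀ s) (k.app _ ≫ X.map s) (by
      rw [Category.assoc, f.naturality, reassoc_of% hk₀])).unique ⟨?_, fun l' h₁ h₂ => ?_⟩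
      ⟨?_, fun l' h₁ h₂ => ?_⟩
    · rw [Category.assoc, hm₁, h.naturality]
    · have : l' = V.map s ≫ l := by
        apply h₀.isPullback.hom_ext
        · rw [h₁, Category.assoc, hl₁, v₁.naturality_assoc]
        · rw [h₂, Category.assoc, hl₂, v₂.naturality]
      rw [this, Category.assoc, hm₂ l hl₁ hl₂, k.naturality]
    · rw [Category.assoc, (ha s).1, reassoc_of% hm₁]
    · have : l' = l ≫ b s := by
        apply h₀.isPullback.hom_ext
        · rw [h₁, Category.assoc, hb₁, reassoc_of% hl₁]
        · rw [h₂, Category.assoc, hb₂, reassoc_of% hl₂]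
      rw [this, Category.assoc, hb₃, reassoc_of% (hm₂ l hl₁ hl₂)]
  refine ⟨SingleObj.natTransMk m hnat, ⟨SingleObj.natTrans_ext hm₁, fun l' h₁ h₂ =>
    SingleObj.natTrans_ext (hm₂ (l'.app _) (NatTrans.congr_app h₁ _)
      (NatTrans.congr_app h₂ _))⟩, ?_⟩
  rintro m' ⟨hm₁', hm₂'⟩
  refine SingleObj.natTrans_ext (hm₃ (m'.app _) ⟨NatTrans.congr_app hm₁' _, fun l' h₁ h₂ => ?_⟩)
  -- The test map `l'` is not assumed equivariant, but its projections are those of the equivariant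
  -- `l''`, so it is the map underlying `l''`.
  let l'' : V ⟶ W := hW.lift (v₁ ≫ m') v₂ (by rw [Category.assoc, hm₁', hp.w])
  have h₃ : l'' ≫ w₁' = v₁ ≫ m' := hW.lift_fst _ _ _
  have h₄ : l'' ≫ w₂' = v₂ := hW.lift_snd _ _ _
  have h₅ : l' = l''.app _ := h₀.isPullback.hom_ext
    (h₁.trans (NatTrans.congr_app h₃ _).symm) (h₂.trans (NatTrans.congr_app h₄ _).symm)
  rw [h₅]
  exact NatTrans.congr_app (hm₂' l'' h₃ h₄) _

end Action

/-! ## Universal sections of groupoids -/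

section Groupoids

namespace CategoryTheory.Grpd

variable {X A B : Grpd.{w, w}} {g : A ⟶ B} (hg : IsGroupoidFibration (g : A ⥤ B)) (f : X ⟶ A)

/-- The dependent product as an object of the category of groupoids. -/
noncomputable abbrev pi : Grpd.{w, w} := Grpd.of (PiObj hg (f : X ⥤ A))

/-- The projection of the dependent product. -/
noncomputable def piProj : pi hg f ⟶ B := PiObj.proj hg (f : X ⥤ A)

/-- Evaluation of sections. -/
noncomputable def piEval : strictPullback (piProj hg f) g ⟶ X := PiObj.eval hg (f : X ⥤ A)

/-- The morphism of pullbacks induced by a morphism to the dependent product. -/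
noncomputable def piLift {H : Grpd.{w, w}} {h : H ⟶ B} (m : H ⟶ pi hg f)
    (e : m ≫ piProj hg f = h) : strictPullback h g ⟶ strictPullback (piProj hg f) g :=
  (isPullback_strictPullback (piProj hg f) g).lift (pullbackFst h g ≫ m) (pullbackSnd h g)
    (by rw [Category.assoc, e, (isPullback_strictPullback h g).w])

theorem piLift_eq {H : Grpd.{w, w}} {h : H ⟶ B} (m : H ⟶ pi hg f)
    (e : m ≫ piProj hg f = h) : piLift hg f m e =
      StrictPullback.lift (h := PiObj.proj hg (f : X ⥤ A)) (g := (g : A ⥤ B))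
        (StrictPullback.fstFunctor (h : H ⥤ B) (g : A ⥤ B) ⋙ (m : H ⥤ PiObj hg (f : X ⥤ A)))
        (StrictPullback.sndFunctor (h : H ⥤ B) (g : A ⥤ B))
        ((congrArg (StrictPullback.fstFunctor (h : H ⥤ B) (g : A ⥤ B) ⋙ ·) e).trans
          (StrictPullback.condition (h : H ⥤ B) (g : A ⥤ B))) :=
  (isPullback_strictPullback (piProj hg f) g).hom_ext
    ((isPullback_strictPullback (piProj hg f) g).lift_fst _ _ _)
    ((isPullback_strictPullback (piProj hg f) g).lift_snd _ _ _)

theorem exists_piLift_comp_piEval {H : Grpd.{w, w}} {h : H ⟶ B} (k : strictPullback h g ⟶ X)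
    (hk : k ≫ f = pullbackSnd h g) :
    ∃ (m : H ⟶ pi hg f) (e : m ≫ piProj hg f = h), piLift hg f m e ≫ piEval hg f = k := by
  refine ⟨PiObj.curry (h := (h : H ⥤ B)) (k : StrictPullback (h : H ⥤ B) (g : A ⥤ B) ⥤ X) hk,
    rfl, ?_⟩
  exact congrArg (· ≫ piEval hg f) (piLift_eq hg f _ rfl)

theorem eq_of_piLift_comp_piEval {H : Grpd.{w, w}} {h : H ⟶ B} {m m' : H ⟶ pi hg f}
    (e : m ≫ piProj hg f = h) (e' : m' ≫ piProj hg f = h)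
    (hm : piLift hg f m' e' ≫ piEval hg f = piLift hg f m e ≫ piEval hg f) : m' = m := by
  subst e
  rw [piLift_eq, piLift_eq] at hm
  exact PiObj.eq_of_uncurry_heq (m := (m : H ⥤ PiObj hg (f : X ⥤ A)))
    (m' := (m' : H ⥤ PiObj hg (f : X ⥤ A))) e' hm

/-- An arbitrary pullback `V` is identified with the strict one, where the statement is currying. -/
theorem isUniversalSection_piEval :
    IsUniversalSection g f (piProj hg f) (pullbackFst (piProj hg f) g)
      (pullbackSnd (piProj hg f) g) (piEval hg f) where
  isPullback := isPullback_strictPullback _ _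
  comp_eq := PiObj.eval_comp hg (f : X ⥤ A)
  existsUnique {H V} h v₁ v₂ hp k hk := by
    let i : V ≅ strictPullback h g := hp.isoIsPullback _ _ (isPullback_strictPullback h g)
    have hi₁ : i.inv ≫ v₁ = pullbackFst h g := by simp [i]
    have hi₂ : i.inv ≫ v₂ = pullbackSnd h g := by simp [i]
    have key : ∀ (m : H ⟶ pi hg f) (e : m ≫ piProj hg f = h)
        (l : V ⟶ strictPullback (piProj hg f) g), l ≫ pullbackFst (piProj hg f) g = v₁ ≫ m →
        l ≫ pullbackSnd (piProj hg f) g = v₂ → i.inv ≫ l = piLift hg f m e := by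
      intro m e l h₁ h₂
      apply (isPullback_strictPullback (piProj hg f) g).hom_ext
      · rw [Category.assoc, h₁, reassoc_of% hi₁, piLift, IsPullback.lift_fst]
      · rw [Category.assoc, h₂, hi₂, piLift, IsPullback.lift_snd]
    obtain ⟨m, e, hm⟩ := exists_piLift_comp_piEval hg f (i.inv ≫ k) (by
      rw [Category.assoc, hk, hi₂])
    refine ⟨m, ⟨e, fun l h₁ h₂ => ?_⟩, ?_⟩
    · rw [← cancel_epi i.inv, ← hm, ← key m e l h₁ h₂, Category.assoc]
    · rintro m' ⟨e', he'⟩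
      refine eq_of_piLift_comp_piEval hg f e e' ?_
      rw [hm, ← he' (i.hom ≫ piLift hg f m' e') ?_ ?_, Category.assoc, Iso.inv_hom_id_assoc]
      · rw [Category.assoc, piLift, IsPullback.lift_fst, ← hi₁, Category.assoc,
          Iso.hom_inv_id_assoc]
      · rw [Category.assoc, piLift, IsPullback.lift_snd, ← hi₂, Iso.hom_inv_id_assoc]

end CategoryTheory.Grpd

end Groupoids

/-! ## Conjugation by arrows of a groupoid -/

section Conjugation

variable {Y : Type*} [Groupoid Y]

/-- The conjugate of a morphism by two arrows. -/
noncomputable def conjArrow (a b : Arrow Y) {x y : Y} (hx : a.left = x) (hy : b.left = y)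
    (m : x ⟶ y) : a.right ⟶ b.right :=
  inv a.hom ≫ eqToHom hx ≫ m ≫ eqToHom hy.symm ≫ b.hom

theorem conjArrow_heq {a a' b b' : Arrow Y} (ha : a = a') (hb : b = b') {x y x' y' : Y}
    (hx : a.left = x) (hy : b.left = y) (hx' : a'.left = x') (hy' : b'.left = y') {m : x ⟶ y}
    {m' : x' ⟶ y'} (hm : m ≍ m') : conjArrow a b hx hy m ≍ conjArrow a' b' hx' hy' m' := by
  subst ha hb hx hy
  obtain rfl : a.left = x' := hx'
  obtain rfl : b.left = y' := hy'
  rw [eq_of_heq hm]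

theorem conjArrow_id (a : Arrow Y) {x : Y} (hx : a.left = x) :
    conjArrow a a hx hx (𝟙 x) = 𝟙 a.right := by
  subst hx
  simp [conjArrow]

theorem conjArrow_comp (a b c : Arrow Y) {x y z : Y} (hx : a.left = x) (hy : b.left = y)
    (hz : c.left = z) (m : x ⟶ y) (n : y ⟶ z) :
    conjArrow a c hx hz (m ≫ n) = conjArrow a b hx hy m ≫ conjArrow b c hy hz n := by
  subst hx hy hz
  simp [conjArrow]

theorem map_conjArrow {Z : Type*} [Groupoid Z] (F : Y ⥤ Z) (a b : Arrow Y) {x y : Y}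
    (hx : a.left = x) (hy : b.left = y) (m : x ⟶ y) :
    F.map (conjArrow a b hx hy m) = conjArrow (F.mapArrow.obj a) (F.mapArrow.obj b)
      (congrArg F.obj hx) (congrArg F.obj hy) (F.map m) := by
  subst hx hy
  change F.map (inv a.hom ≫ 𝟙 _ ≫ m ≫ 𝟙 _ ≫ b.hom) =
    inv (F.map a.hom) ≫ 𝟙 _ ≫ F.map m ≫ 𝟙 _ ≫ F.map b.hom
  simp

theorem conjArrow_mk_id {x y : Y} (m : x ⟶ y) :
    conjArrow (Arrow.mk (𝟙 x)) (Arrow.mk (𝟙 y)) rfl rfl m = m := by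
  simp [conjArrow]

end Conjugation

/-! ## Factorization -/

section Factorization

variable {G : Type} [Group G]

namespace SingleObj

/-- The action of a group element on the arrows of a groupoid. -/
def arrowAct (F : SingleObj G ⥤ Grpd.{w, w}) (s : G) (a : Arrow (F.obj (SingleObj.star G))) :
    Arrow (F.obj (SingleObj.star G)) :=
  (Functor.mapArrow (F.map (X := SingleObj.star G) (Y := SingleObj.star G) s :
    F.obj (SingleObj.star G) ⥤ F.obj (SingleObj.star G))).obj a

/-- The action of a group element on a groupoid. -/
abbrev actFunctor (F : SingleObj G ⥤ Grpd.{w, w}) (s : G) :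
    F.obj (SingleObj.star G) ⥤ F.obj (SingleObj.star G) :=
  F.map (X := SingleObj.star G) (Y := SingleObj.star G) s

theorem actFunctor_one (F : SingleObj G ⥤ Grpd.{w, w}) :
    actFunctor F (1 : G) = 𝟭 (F.obj (SingleObj.star G)) :=
  F.map_id _

theorem actFunctor_mul (F : SingleObj G ⥤ Grpd.{w, w}) (t s : G) :
    actFunctor F (t * s) = actFunctor F s ⋙ actFunctor F t :=
  F.map_comp (X := SingleObj.star G) (Y := SingleObj.star G) (Z := SingleObj.star G) s t

/-- The functor underlying an equivariant functor. -/
abbrev appFunctor {F F' : SingleObj G ⥤ Grpd.{w, w}} (α : F ⟶ F') :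
    F.obj (SingleObj.star G) ⥤ F'.obj (SingleObj.star G) :=
  α.app (SingleObj.star G)

theorem actFunctor_comp_appFunctor {F F' : SingleObj G ⥤ Grpd.{w, w}} (α : F ⟶ F') (s : G) :
    actFunctor F s ⋙ appFunctor α = appFunctor α ⋙ actFunctor F' s :=
  α.naturality (X := SingleObj.star G) (Y := SingleObj.star G) s

theorem arrowAct_one (F : SingleObj G ⥤ Grpd.{w, w}) (a : Arrow (F.obj (SingleObj.star G))) :
    arrowAct F 1 a = a := by
  change (actFunctor F 1).mapArrow.obj a = a
  rw [actFunctor_one]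
  rfl

theorem arrowAct_mul (F : SingleObj G ⥤ Grpd.{w, w}) (t s : G)
    (a : Arrow (F.obj (SingleObj.star G))) :
    arrowAct F (t * s) a = arrowAct F t (arrowAct F s a) := by
  change (actFunctor F (t * s)).mapArrow.obj a = _
  rw [actFunctor_mul]
  rfl

theorem mapArrow_arrowAct {F F' : SingleObj G ⥤ Grpd.{w, w}} (α : F ⟶ F') (s : G)
    (a : Arrow (F.obj (SingleObj.star G))) :
    (appFunctor α).mapArrow.obj (arrowAct F s a) =
      arrowAct F' s ((appFunctor α).mapArrow.obj a) := by
  change (actFunctor F s ⋙ appFunctor α).mapArrow.obj a = _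
  rw [actFunctor_comp_appFunctor]
  rfl

theorem arrowAct_mk_id (F : SingleObj G ⥤ Grpd.{w, w}) (s : G)
    (x : F.obj (SingleObj.star G)) :
    arrowAct F s (Arrow.mk (𝟙 x)) = Arrow.mk (𝟙 ((actFunctor F s).obj x)) :=
  congrArg (fun m => Arrow.mk m) ((actFunctor F s).map_id x)

end SingleObj

open SingleObj

variable {X Y : SingleObj G ⥤ Grpd.{w, w}} (f : X ⟶ Y)

/-- Objects of the equivariant mapping path groupoid: the objects of `X`, and freely permuted paths
in `Y` starting at the image of an object of `X`. -/
@[ext]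
structure PathObj : Type w where
  pt : X.obj (SingleObj.star G)
  arrow : Arrow (Y.obj (SingleObj.star G))
  tag : Option G
  left_eq : arrow.left = (appFunctor f).obj pt
  arrow_eq : tag = none → arrow = Arrow.mk (𝟙 ((appFunctor f).obj pt))

namespace PathObj

/-- Morphisms ignore paths and tags, so every path is canonically isomorphic to the object of `X` at
which it starts. -/
noncomputable instance : Groupoid.{w} (PathObj f) where
  Hom e e' := e.pt ⟶ e'.pt
  id e := 𝟙 e.pt
  comp m n := CategoryStruct.comp (obj := X.obj (SingleObj.star G)) m n
  id_comp _ := Category.id_comp (obj := X.obj (SingleObj.star G)) _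
  comp_id _ := Category.comp_id (obj := X.obj (SingleObj.star G)) _
  assoc _ _ _ := Category.assoc (obj := X.obj (SingleObj.star G)) _ _ _
  inv {e e'} m := inv (C := X.obj (SingleObj.star G)) (X := e.pt) (Y := e'.pt) m
  inv_comp {e e'} m := IsIso.inv_hom_id (C := X.obj (SingleObj.star G)) (X := e.pt) (Y := e'.pt) m
  comp_inv {e e'} m := IsIso.hom_inv_id (C := X.obj (SingleObj.star G)) (X := e.pt) (Y := e'.pt) m

/-- Morphisms between path objects are the morphisms between their starting points. -/
def homMk {e e' : PathObj f} (m : e.pt ⟶ e'.pt) : e ⟶ e' := m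

/-- The starting point of a path. -/
def ptFunctor : PathObj f ⥤ X.obj (SingleObj.star G) where
  obj e := e.pt
  map m := m
  map_id _ := rfl
  map_comp _ _ := rfl

/-- The end point of a path. -/
noncomputable def endpoint : PathObj f ⥤ Y.obj (SingleObj.star G) where
  obj e := e.arrow.right
  map {e e'} m := conjArrow e.arrow e'.arrow e.left_eq e'.left_eq
    ((appFunctor f).map ((ptFunctor f).map m))
  map_id e := (congrArg (conjArrow e.arrow e.arrow e.left_eq e.left_eq)
    ((appFunctor f).map_id e.pt)).trans (conjArrow_id _ _)
  map_comp {e e' e''} m n := (congrArg (conjArrow e.arrow e''.arrow e.left_eq e''.left_eq)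
    ((appFunctor f).map_comp ((ptFunctor f).map m) ((ptFunctor f).map n))).trans
      (conjArrow_comp _ _ _ _ e'.left_eq _ _ _)

/-- The inclusion of the objects of `X`. -/
def ofPt : X.obj (SingleObj.star G) ⥤ PathObj f where
  obj x := ⟨x, Arrow.mk (𝟙 _), none, rfl, fun _ => rfl⟩
  map m := m
  map_id _ := rfl
  map_comp _ _ := rfl

theorem hext {e₁ e₂ e₁' e₂' : PathObj f} (h₁ : e₁ = e₁') (h₂ : e₂ = e₂') (m : e₁ ⟶ e₂)
    (m' : e₁' ⟶ e₂') (h : (ptFunctor f).map m ≍ (ptFunctor f).map m') : m ≍ m' := by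
  subst h₁ h₂
  exact h

/-- The action on path objects. -/
def actObj (s : G) (e : PathObj f) : PathObj f where
  pt := (actFunctor X s).obj e.pt
  arrow := arrowAct Y s e.arrow
  tag := e.tag.map (s * ·)
  left_eq := (congrArg (actFunctor Y s).obj e.left_eq).trans
    (Functor.congr_obj (actFunctor_comp_appFunctor f s) e.pt).symm
  arrow_eq h := by
    rw [e.arrow_eq (by simpa using h), arrowAct_mk_id]
    exact congrArg (fun x => Arrow.mk (𝟙 x))
      (Functor.congr_obj (actFunctor_comp_appFunctor f s) e.pt).symm

theorem actObj_one (e : PathObj f) : actObj f 1 e = e :=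
  PathObj.ext (Functor.congr_obj (actFunctor_one X) e.pt) (arrowAct_one Y e.arrow) (by
    simp [actObj])

theorem actObj_mul (t s : G) (e : PathObj f) :
    actObj f (t * s) e = actObj f t (actObj f s e) :=
  PathObj.ext (Functor.congr_obj (actFunctor_mul X t s) e.pt) (arrowAct_mul Y t s e.arrow) (by
    simp [actObj, Function.comp_def, mul_assoc])

/-- The action on the path groupoid. -/
def act (s : G) : PathObj f ⥤ PathObj f where
  obj e := actObj f s e
  map m := (actFunctor X s).map ((ptFunctor f).map m)
  map_id _ := (actFunctor X s).map_id _
  map_comp _ _ := (actFunctor X s).map_comp _ _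

theorem act_one : act f (1 : G) = 𝟭 (PathObj f) :=
  Functor.hext (actObj_one f) fun _ _ m =>
    hext f (actObj_one f _) (actObj_one f _) _ _ (Functor.hcongr_hom (actFunctor_one X)
      ((ptFunctor f).map m))

theorem act_mul (t s : G) : act f (t * s) = act f s ⋙ act f t :=
  Functor.hext (actObj_mul f t s) fun _ _ m =>
    hext f (actObj_mul f t s _) (actObj_mul f t s _) _ _ (Functor.hcongr_hom
      (actFunctor_mul X t s) ((ptFunctor f).map m))

/-- The equivariant mapping path groupoid. -/
noncomputable def pathObject : SingleObj G ⥤ Grpd.{w, w} :=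
  SingleObj.functorMk (Grpd.of (PathObj f)) (act f) (act_one f) fun s t => act_mul f t s

/-- The inclusion of `X` in the equivariant mapping path groupoid. -/
noncomputable def inclusion : X ⟶ pathObject f :=
  SingleObj.natTransMk (F' := pathObject f) (ofPt f) fun s => by
    have hobj : ∀ x, (ofPt f).obj ((actFunctor X s).obj x) = actObj f s ((ofPt f).obj x) :=
      fun x => PathObj.ext rfl (by
        refine Eq.trans ?_ (arrowAct_mk_id Y s _).symm
        exact congrArg (fun x => Arrow.mk (𝟙 x))
          (Functor.congr_obj (actFunctor_comp_appFunctor f s) x)) rfl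
    exact Functor.hext (F := actFunctor X s ⋙ ofPt f) (G := ofPt f ⋙ act f s) hobj fun x y m =>
      hext f (hobj x) (hobj y) _ _ HEq.rfl

/-- The projection to `Y` from the equivariant mapping path groupoid. -/
noncomputable def projection : pathObject f ⟶ Y :=
  SingleObj.natTransMk (F := pathObject f) (endpoint f) fun s =>
    Functor.hext (F := act f s ⋙ endpoint f) (G := endpoint f ⋙ actFunctor Y s) (fun _ => rfl)
      fun e e' m => by
        refine HEq.trans ?_ (heq_of_eq (map_conjArrow (actFunctor Y s) e.arrow e'.arrow e.left_eq
          e'.left_eq ((appFunctor f).map ((ptFunctor f).map m))).symm)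
        exact conjArrow_heq rfl rfl (actObj f s e).left_eq (actObj f s e').left_eq
          (congrArg (actFunctor Y s).obj e.left_eq) (congrArg (actFunctor Y s).obj e'.left_eq)
          (Functor.hcongr_hom (actFunctor_comp_appFunctor f s)
          ((ptFunctor f).map m))

theorem inclusion_comp_projection : inclusion f ≫ projection f = f :=
  SingleObj.natTrans_ext (Functor.hext (F := ofPt f ⋙ endpoint f) (G := appFunctor f)
    (fun _ => rfl) fun _ _ m => heq_of_eq (conjArrow_mk_id ((appFunctor f).map m)))

theorem isGroupoidFibration_endpoint : IsGroupoidFibration (endpoint f) := by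
  intro e b φ
  change e.arrow.right ⟶ b at φ
  -- Extend the path by `φ`. Any group element would serve as the tag; `none` would not, since it
  -- forces an identity path.
  let e' : PathObj f := ⟨e.pt, Arrow.mk (e.arrow.hom ≫ φ), some 1, e.left_eq, nofun⟩
  let m : e ⟶ e' := homMk f (𝟙 e.pt)
  have hm : (endpoint f).map m = φ := by
    change conjArrow e.arrow e'.arrow e.left_eq e.left_eq ((appFunctor f).map (𝟙 e.pt)) = φ
    simp [conjArrow, e']
  have : (endpoint f).IsHomLift ((endpoint f).map m) m := .map m
  rw [hm] at this
  exact ⟨e', m, this⟩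

end PathObj

end Factorization

/-! ### The left lifting property of the inclusion into the path groupoid -/

section Lifting

variable {G : Type} [Group G]

open SingleObj

theorem CategoryTheory.Arrow.ext_of_heq {C : Type*} [Category* C] {a b : Arrow C}
    (h₁ : a.left = b.left) (h₂ : a.right = b.right) (h₃ : a.hom ≍ b.hom) : a = b := by
  obtain ⟨x, y, m⟩ := a
  obtain ⟨x', y', m'⟩ := b
  obtain rfl : x = x' := h₁
  obtain rfl : y = y' := h₂
  obtain rfl := eq_of_heq h₃
  rfl

namespace PathObj

variable {X Y : SingleObj G ⥤ Grpd.{w, w}} (f : X ⟶ Y)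

/-- The canonical morphism from the starting point of a path to the path. -/
noncomputable def canonical (e : PathObj f) : Arrow (PathObj f) :=
  Arrow.mk (homMk f (e := (ofPt f).obj e.pt) (e' := e) (𝟙 e.pt))

theorem actObj_ofPt (s : G) (x : X.obj (SingleObj.star G)) :
    actObj f s ((ofPt f).obj x) = (ofPt f).obj ((actFunctor X s).obj x) :=
  (Functor.congr_obj (actFunctor_comp_appFunctor (inclusion f) s) x).symm

theorem arrowAct_canonical (s : G) (e : PathObj f) :
    arrowAct (pathObject f) s (canonical f e) = canonical f (actObj f s e) :=
  Arrow.ext_of_heq (actObj_ofPt f s e.pt) rfl (hext f (actObj_ofPt f s e.pt) rfl _ _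
    (heq_of_eq ((actFunctor X s).map_id e.pt)))

theorem eq_ofPt_of_tag_eq_none {e : PathObj f} (h : e.tag = none) :
    (ofPt f).obj e.pt = e :=
  PathObj.ext rfl (e.arrow_eq h).symm h.symm

theorem canonical_of_tag_eq_none {e : PathObj f} (h : e.tag = none) :
    canonical f e = Arrow.mk (𝟙 e) :=
  Arrow.ext_of_heq (eq_ofPt_of_tag_eq_none f h) rfl
    (hext f (eq_ofPt_of_tag_eq_none f h) rfl _ _ HEq.rfl)

variable {P Q : SingleObj G ⥤ Grpd.{w, w}} {p : P ⟶ Q} {u : X ⟶ P} {v : pathObject f ⟶ Q}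

/-- A lift at a single path, without equivariance. -/
theorem exists_lift_canonical (hp : IsGroupoidFibration (appFunctor p))
    (h : u ≫ p = inclusion f ≫ v) (e : PathObj f) :
    ∃ a : Arrow (P.obj (SingleObj.star G)), a.left = (appFunctor u).obj e.pt ∧
      (appFunctor p).mapArrow.obj a = (appFunctor v).mapArrow.obj (canonical f e) := by
  have hw : appFunctor u ⋙ appFunctor p = ofPt f ⋙ appFunctor v := NatTrans.congr_app h _
  obtain ⟨x, ψ, hψ⟩ := hp.exists_lift ((appFunctor v).map (canonical f e).hom)
    ((appFunctor u).obj e.pt) (Functor.congr_obj hw e.pt)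
  exact ⟨Arrow.mk ψ, rfl, Arrow.ext_of_heq (Functor.congr_obj hw e.pt)
    (@IsHomLift.codomain_eq _ _ _ _ (appFunctor p) _ _ _ _ _ ψ hψ)
    (map_heq_of_isHomLift hψ)⟩

/-- The group acts freely on the tags `some t`, so arbitrary lifts at `some 1` extend equivariantly.
At `none` the canonical arrow is an identity, so identities lift it, equivariantly and compatibly
with `u`. -/
theorem exists_equivariant_lift_canonical (hp : IsGroupoidFibration (appFunctor p))
    (h : u ≫ p = inclusion f ≫ v) :
    ∃ a : PathObj f → Arrow (P.obj (SingleObj.star G)),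
      (∀ e, (a e).left = (appFunctor u).obj e.pt) ∧
      (∀ e, (appFunctor p).mapArrow.obj (a e) =
        (appFunctor v).mapArrow.obj (canonical f e)) ∧
      (∀ s e, a (actObj f s e) = arrowAct P s (a e)) ∧
      ∀ x, a ((ofPt f).obj x) = Arrow.mk (𝟙 ((appFunctor u).obj x)) := by
  have hw : appFunctor u ⋙ appFunctor p = ofPt f ⋙ appFunctor v := NatTrans.congr_app h _
  choose a₀ h₁ h₂ using exists_lift_canonical f hp h
  -- A path tagged `t` is translated by `t⁻¹` to the tag `1`, lifted there by `a₀`, and the lift is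
  -- translated back.
  obtain ⟨a, ha, ha'⟩ : ∃ a : PathObj f → Arrow (P.obj (SingleObj.star G)),
      (∀ e, e.tag = none → a e = Arrow.mk (𝟙 ((appFunctor u).obj e.pt))) ∧
      ∀ e t, e.tag = some t → a e = arrowAct P t (a₀ (actObj f t⁻¹ e)) :=
    ⟨fun e => e.tag.elim (Arrow.mk (𝟙 ((appFunctor u).obj e.pt)))
      fun t => arrowAct P t (a₀ (actObj f t⁻¹ e)),
      fun e h => congrArg (fun z => Option.elim z _ _) h,
      fun e t h => congrArg (fun z => Option.elim z _ _) h⟩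
  have hinv : ∀ t e, actObj f t (actObj f t⁻¹ e) = e := fun t e => by
    rw [← actObj_mul, mul_inv_cancel, actObj_one]
  refine ⟨a, ?_, ?_, ?_, fun _ => ha _ rfl⟩
  · intro e
    rcases ht : e.tag with _ | t
    · exact congrArg (fun z => z.left) (ha e ht)
    · refine (congrArg (fun z => z.left) (ha' e t ht)).trans ?_
      refine (congrArg (actFunctor P t).obj (h₁ _)).trans ?_
      refine (Functor.congr_obj (actFunctor_comp_appFunctor u t) _).symm.trans ?_
      exact congrArg (appFunctor u).obj (congrArg PathObj.pt (hinv t e))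
  · intro e
    rcases ht : e.tag with _ | t
    · have h₃ : (appFunctor p).obj ((appFunctor u).obj e.pt) = (appFunctor v).obj e :=
        (Functor.congr_obj hw e.pt).trans
          (congrArg (appFunctor v).obj (eq_ofPt_of_tag_eq_none f ht))
      refine (congrArg (appFunctor p).mapArrow.obj (ha e ht)).trans ?_
      refine Eq.trans ?_ (congrArg (appFunctor v).mapArrow.obj
        (canonical_of_tag_eq_none f ht)).symm
      refine (congrArg (fun m => Arrow.mk m) ((appFunctor p).map_id _)).trans ?_
      refine Eq.trans ?_ (congrArg (fun m => Arrow.mk m) ((appFunctor v).map_id e)).symm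
      exact congrArg (fun x => Arrow.mk (𝟙 x)) h₃
    · refine (congrArg (appFunctor p).mapArrow.obj (ha' e t ht)).trans ?_
      refine (mapArrow_arrowAct p t _).trans ?_
      refine (congrArg (arrowAct Q t) (h₂ _)).trans ?_
      refine (mapArrow_arrowAct v t _).symm.trans ?_
      refine congrArg (appFunctor v).mapArrow.obj ?_
      exact (arrowAct_canonical f t _).trans (congrArg (canonical f) (hinv t e))
  · intro s e
    rcases ht : e.tag with _ | t
    · refine (ha (actObj f s e) (by simp [actObj, ht])).trans ?_
      refine Eq.trans ?_ (congrArg (arrowAct P s) (ha e ht)).symm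
      refine Eq.trans ?_ (arrowAct_mk_id P s _).symm
      exact congrArg (fun x => Arrow.mk (𝟙 x))
        (Functor.congr_obj (actFunctor_comp_appFunctor u s) e.pt)
    · refine (ha' (actObj f s e) (s * t) (by simp [actObj, ht])).trans ?_
      refine Eq.trans ?_ (congrArg (arrowAct P s) (ha' e t ht)).symm
      rw [arrowAct_mul, ← actObj_mul, mul_inv_rev, inv_mul_cancel_right]

/-- Every morphism of paths is a conjugate, by canonical arrows, of a morphism coming from `X`. A
functor on paths is thus determined by its values on `X` and on canonical arrows. -/
theorem conjArrow_canonical {e e' : PathObj f} (m : e ⟶ e') :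
    conjArrow (canonical f e) (canonical f e') rfl rfl ((ofPt f).map ((ptFunctor f).map m)) =
      m := by
  refine (IsIso.inv_comp_eq _).2 ?_
  refine (Category.id_comp _).trans ?_
  refine (congrArg (_ ≫ ·) (Category.id_comp _)).trans ?_
  exact (Category.comp_id (X := e.pt) (Y := e'.pt) ((ptFunctor f).map m)).trans
    (Category.id_comp (X := e.pt) (Y := e'.pt) ((ptFunctor f).map m)).symm

/-- The diagonal sends a path to the end of its chosen lift and a morphism to the conjugate of its
image under `u`. Equivariance and both triangles come from the corresponding properties of the
chosen lifts. -/
theorem hasLiftingProperty_inclusion (hp : IsGroupoidFibration (appFunctor p)) :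
    HasLiftingProperty (inclusion f) p where
  sq_hasLift {u v} sq := by
    obtain ⟨a, h₁, h₂, h₃, h₄⟩ := exists_equivariant_lift_canonical f hp sq.w
    let l : PathObj f ⥤ P.obj (SingleObj.star G) :=
      { obj := fun e => (a e).right
        map := fun {e e'} m => conjArrow (a e) (a e') (h₁ e) (h₁ e')
          ((appFunctor u).map ((ptFunctor f).map m))
        map_id := fun e => (congrArg (conjArrow (a e) (a e) (h₁ e) (h₁ e))
          ((appFunctor u).map_id e.pt)).trans (conjArrow_id _ _)
        map_comp := fun {e e' e''} m n => (congrArg (conjArrow (a e) (a e'') (h₁ e) (h₁ e''))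
          ((appFunctor u).map_comp ((ptFunctor f).map m) ((ptFunctor f).map n))).trans
            (conjArrow_comp _ _ _ _ (h₁ e') _ _ _) }
    have hl : ∀ s, act f s ⋙ l = l ⋙ actFunctor P s := fun s =>
      Functor.hext (fun e => congrArg (fun z => z.right) (h₃ s e)) fun e e' m => by
        refine HEq.trans ?_ (heq_of_eq (map_conjArrow (actFunctor P s) (a e) (a e') (h₁ e)
          (h₁ e') ((appFunctor u).map ((ptFunctor f).map m))).symm)
        exact conjArrow_heq (h₃ s e) (h₃ s e') (h₁ (actObj f s e)) (h₁ (actObj f s e'))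
          (congrArg (actFunctor P s).obj (h₁ e)) (congrArg (actFunctor P s).obj (h₁ e'))
          (Functor.hcongr_hom (actFunctor_comp_appFunctor u s) ((ptFunctor f).map m))
    have hw : appFunctor u ⋙ appFunctor p = ofPt f ⋙ appFunctor v := NatTrans.congr_app sq.w _
    refine ⟨⟨⟨SingleObj.natTransMk (F := pathObject f) l hl, ?_, ?_⟩⟩⟩
    · refine SingleObj.natTrans_ext (Functor.hext (F := ofPt f ⋙ l) (G := appFunctor u)
        (fun x => congrArg (fun z => z.right) (h₄ x)) fun x y m => ?_)
      refine HEq.trans ?_ (heq_of_eq (conjArrow_mk_id ((appFunctor u).map m)))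
      exact conjArrow_heq (h₄ x) (h₄ y) (h₁ ((ofPt f).obj x)) (h₁ ((ofPt f).obj y)) rfl rfl HEq.rfl
    · refine SingleObj.natTrans_ext (Functor.hext (F := l ⋙ appFunctor p) (G := appFunctor v)
        (fun e => congrArg (fun z => z.right) (h₂ e)) fun e e' m => ?_)
      refine (heq_of_eq (map_conjArrow (appFunctor p) (a e) (a e') (h₁ e)
          (h₁ e') ((appFunctor u).map ((ptFunctor f).map m)))).trans ?_
      refine HEq.trans (conjArrow_heq (h₂ e) (h₂ e') (congrArg (appFunctor p).obj (h₁ e))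
        (congrArg (appFunctor p).obj (h₁ e')) rfl rfl
          (m' := (appFunctor v).map ((ofPt f).map ((ptFunctor f).map m)))
          (Functor.hcongr_hom hw ((ptFunctor f).map m))) ?_
      refine (heq_of_eq (map_conjArrow (appFunctor v) (canonical f e) (canonical f e') rfl rfl
        ((ofPt f).map ((ptFunctor f).map m)))).symm.trans (heq_of_eq ?_)
      exact congrArg (appFunctor v).map (conjArrow_canonical f m)

end PathObj

end Lifting

/-! ## Discrete groupoids -/

section DiscreteGroupoids

theorem discreteFunctor_ext {α β : Type*} {F F' : Discrete α ⥤ Discrete β}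
    (h : ∀ x, F.obj ⟨x⟩ = F'.obj ⟨x⟩) : F = F' :=
  CategoryTheory.Functor.ext (fun x => h x.as) fun _ _ _ => Subsingleton.elim _ _

/-- The isomorphism of discrete groupoids given by a bijection. -/
def discreteIso {α β : Type u} (e : α ≃ β) :
    (Grpd.of (Discrete α) : Grpd.{u, u}) ≅ Grpd.of (Discrete β) where
  hom := Discrete.functor fun x => ⟨e x⟩
  inv := Discrete.functor fun x => ⟨e.symm x⟩
  hom_inv_id := discreteFunctor_ext fun x => congrArg Discrete.mk (e.symm_apply_apply x)
  inv_hom_id := discreteFunctor_ext fun x => congrArg Discrete.mk (e.apply_symm_apply x)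

end DiscreteGroupoids

/-! ## Transport in discrete fibrations -/

section Transport

variable {A : Type*} {B : Type*} [Groupoid A] [Groupoid B] {F : A ⥤ B}

namespace IsDiscreteGroupoidFibration

variable (hF : IsDiscreteGroupoidFibration F)

/-- Transport along a morphism of the base, as a function. -/
noncomputable def transportFun {b b' : B} (φ : b ⟶ b') (x : F.Fiber b) : F.Fiber b' :=
  ⟨(hF.1.exists_lift φ x.1 x.2).choose,
    let h := (hF.1.exists_lift φ x.1 x.2).choose_spec
    @IsHomLift.codomain_eq _ _ _ _ F _ _ _ _ φ h.choose h.choose_spec⟩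

theorem transportFun_eq {b b' : B} (φ : b ⟶ b') {x : F.Fiber b} {y : F.Fiber b'} (ψ : x.1 ⟶ y.1)
    (h : F.IsHomLift φ ψ) : hF.transportFun φ x = y :=
  let h' := (hF.1.exists_lift φ x.1 x.2).choose_spec
  Subtype.ext (hF.lift_unique φ h'.choose ψ h'.choose_spec h).1

theorem exists_transportFun {b b' : B} (φ : b ⟶ b') (x : F.Fiber b) :
    ∃ ψ : x.1 ⟶ (hF.transportFun φ x).1, F.IsHomLift φ ψ :=
  (hF.1.exists_lift φ x.1 x.2).choose_spec

theorem transportFun_id {b : B} (x : F.Fiber b) : hF.transportFun (𝟙 b) x = x :=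
  hF.transportFun_eq (𝟙 b) (𝟙 x.1) (IsHomLift.id x.2)

theorem transportFun_comp {b b' b'' : B} (φ : b ⟶ b') (φ' : b' ⟶ b'') (x : F.Fiber b) :
    hF.transportFun (φ ≫ φ') x = hF.transportFun φ' (hF.transportFun φ x) := by
  obtain ⟨ψ, h⟩ := hF.exists_transportFun φ x
  obtain ⟨ψ', h'⟩ := hF.exists_transportFun φ' (hF.transportFun φ x)
  exact hF.transportFun_eq _ (ψ ≫ ψ') inferInstance

/-- Transport along a morphism of the base. -/
noncomputable def transport {b b' : B} (φ : b ⟶ b') : F.Fiber b ≃ F.Fiber b' where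
  toFun := hF.transportFun φ
  invFun := hF.transportFun (inv φ)
  left_inv x := by rw [← transportFun_comp, IsIso.hom_inv_id, transportFun_id]
  right_inv x := by rw [← transportFun_comp, IsIso.inv_hom_id, transportFun_id]

end IsDiscreteGroupoidFibration

end Transport

/-! ## The classifying map of a small discrete fibration -/

section Classifying

theorem UHom.hext {κ : Cardinal.{u}} {X Y X' Y' : UObj κ} (hX : X = X') (hY : Y = Y')
    (f : X ⟶ Y) (g : X' ⟶ Y') (h₁ : UHom.fst f ≍ UHom.fst g) (h₂ : UHom.snd f ≍ UHom.snd g) :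
    f ≍ g := by
  subst hX hY
  exact heq_of_eq (UHom.ext (eq_of_heq h₁) (eq_of_heq h₂))

theorem PtUObj.ext_of_heq {κ : Cardinal.{u}} {X Y : PtUObj κ} (h₁ : X.base = Y.base)
    (h₂ : X.pt ≍ Y.pt) : X = Y := by
  obtain ⟨X, x⟩ := X
  obtain ⟨Y, y⟩ := Y
  obtain rfl : X = Y := h₁
  obtain rfl : x = y := eq_of_heq h₂
  rfl

/-- A cardinal below a lifted one is itself a lift. This allows fibres in the large universe to be
replaced by models in the universe from which `UObj` is built. -/
theorem small_of_mk_lt_lift {α : Type (u + 1)} {κ : Cardinal.{u}}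
    (h : #α < Cardinal.lift.{u + 1} κ) : Small.{u} α := by
  obtain ⟨c, hc⟩ := Cardinal.mem_range_lift_of_le h.le
  rw [← Cardinal.mk_out c, ← Cardinal.mk_uLift] at hc
  obtain ⟨e⟩ := Cardinal.eq.1 hc
  exact ⟨c.out, ⟨e.symm.trans Equiv.ulift⟩⟩

/-- An involution-equivariant discrete fibration with small fibres. -/
structure SmallInvolutiveFibration (κ : Cardinal.{u}) (A B : Type (u + 1)) [Groupoid.{u + 1} A]
    [Groupoid.{u + 1} B] where
  functor : A ⥤ B
  discrete : IsDiscreteGroupoidFibration functor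
  card_lt : ∀ b, #(functor.Fiber b) < Cardinal.lift.{u + 1} κ
  involA : A ⥤ A
  involB : B ⥤ B
  involA_involA : involA ⋙ involA = 𝟭 A
  involB_involB : involB ⋙ involB = 𝟭 B
  involA_functor : involA ⋙ functor = functor ⋙ involB

namespace SmallInvolutiveFibration

variable {κ : Cardinal.{u}} {A B : Type (u + 1)} [Groupoid.{u + 1} A] [Groupoid.{u + 1} B]
  (D : SmallInvolutiveFibration κ A B)

instance small_fiber (b : B) : Small.{u} (D.functor.Fiber b) := small_of_mk_lt_lift (D.card_lt b)

/-- A model of the fibre in the smaller universe. -/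
abbrev Fib (b : B) : Type u := Shrink.{u} (D.functor.Fiber b)

theorem mk_fib_lt (b : B) : #(D.Fib b) < κ := by
  have h : Cardinal.lift.{u} #(D.functor.Fiber b) = Cardinal.lift.{u + 1} #(D.Fib b) :=
    Cardinal.lift_mk_eq'.2 ⟨equivShrink.{u} (D.functor.Fiber b)⟩
  rw [← Cardinal.lift_lt.{u, u + 1}, ← h, Cardinal.lift_id'.{u, u + 1}]
  exact D.card_lt b

/-- A model of the fibre as a discrete groupoid. -/
abbrev fibGrpd (b : B) : Grpd.{u, u} := Grpd.of (Discrete (D.Fib b))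

theorem mk_fibGrpd_lt (b : B) : #(D.fibGrpd b) < κ :=
  (Cardinal.mk_congr discreteEquiv).trans_lt (D.mk_fib_lt b)

/-- The point of the fibre given by an object. -/
noncomputable def point {b : B} (x : D.functor.Fiber b) : D.fibGrpd b :=
  Discrete.mk (equivShrink.{u} _ x)

theorem point_heq {b b' : B} (h : b = b') {x : D.functor.Fiber b} {x' : D.functor.Fiber b'}
    (hx : x.1 = x'.1) : D.point x ≍ D.point x' := by
  subst h
  rw [Subtype.ext hx]

theorem eq_of_point_heq {b b' : B} (h : b = b') {x : D.functor.Fiber b}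
    {x' : D.functor.Fiber b'} (hx : D.point x ≍ D.point x') : x.1 = x'.1 := by
  subst h
  have := congrArg Discrete.as (eq_of_heq hx)
  rw [(equivShrink.{u} _).injective this]

theorem point_surjective {b : B} (z : D.fibGrpd b) : ∃ x : D.functor.Fiber b, D.point x = z :=
  ⟨(equivShrink.{u} _).symm z.as, congrArg Discrete.mk (Equiv.apply_symm_apply _ _)⟩

/-- An isomorphism of fibres given by a bijection. -/
noncomputable def fibIso {b b' : B} (e : D.functor.Fiber b ≃ D.functor.Fiber b') :
    D.fibGrpd b ≅ D.fibGrpd b' :=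
  discreteIso (((equivShrink.{u} _).symm.trans e).trans (equivShrink.{u} _))

theorem fibIso_point {b b' : B} (e : D.functor.Fiber b ≃ D.functor.Fiber b')
    (x : D.functor.Fiber b) : (D.fibIso e).hom.obj (D.point x) = D.point (e x) := by
  refine congrArg Discrete.mk ?_
  change (equivShrink.{u} _) (e ((equivShrink.{u} _).symm (equivShrink.{u} _ x))) = _
  rw [Equiv.symm_apply_apply]

theorem iso_ext {b b' : B} {i j : D.fibGrpd b ≅ D.fibGrpd b'}
    (h : ∀ x : D.functor.Fiber b, i.hom.obj (D.point x) = j.hom.obj (D.point x)) : i = j := by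
  refine Iso.ext (discreteFunctor_ext fun z => ?_)
  obtain ⟨x, hx⟩ := D.point_surjective ⟨z⟩
  rw [← hx]
  exact h x

/-- The bijection between the fibres over a pair of conjugate objects. -/
def involEquiv {b b' : B} (h : D.involB.obj b = b') :
    D.functor.Fiber b ≃ D.functor.Fiber b' where
  toFun x := ⟨D.involA.obj x.1, (Functor.congr_obj D.involA_functor x.1).trans
    ((congrArg D.involB.obj x.2).trans h)⟩
  invFun x := ⟨D.involA.obj x.1, (Functor.congr_obj D.involA_functor x.1).trans
    ((congrArg D.involB.obj (x.2.trans h.symm)).trans (Functor.congr_obj D.involB_involB b))⟩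
  left_inv x := Subtype.ext (Functor.congr_obj D.involA_involA x.1)
  right_inv x := Subtype.ext (Functor.congr_obj D.involA_involA x.1)

/-- The object of the universe given by the fibres over a pair of conjugate objects. -/
noncomputable def fibres {b b' : B} (h : D.involB.obj b = b') : UObj κ where
  fst := D.fibGrpd b
  snd := D.fibGrpd b'
  fst_discrete := Discrete.isDiscrete _
  snd_discrete := Discrete.isDiscrete _
  fst_small := D.mk_fibGrpd_lt b
  snd_small := D.mk_fibGrpd_lt b'
  iso := D.fibIso (D.involEquiv h)

/-- The second fibre is indexed by any `b'` equal to the conjugate of `b`, so that the equation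
between `b` and its double conjugate can be substituted instead of transported along. -/
theorem fibres_congr {b c c' : B} (h : D.involB.obj b = c) (h' : D.involB.obj b = c') :
    D.fibres h = D.fibres h' := by
  subst h h'
  rfl

theorem fibres_symm {b b' : B} (h : D.involB.obj b = b') (h' : D.involB.obj b' = b) :
    D.fibres h' = (UObj.swap κ).obj (D.fibres h) := by
  have : D.fibIso (D.involEquiv h') = (D.fibIso (D.involEquiv h)).symm := by
    refine D.iso_ext fun x => ?_
    rfl
  exact congrArg (fun i => (⟨D.fibGrpd b', D.fibGrpd b, Discrete.isDiscrete _,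
    Discrete.isDiscrete _, D.mk_fibGrpd_lt b', D.mk_fibGrpd_lt b, i⟩ : UObj κ)) this

/-- Transport as an isomorphism of fibres. -/
noncomputable def transportIso {b b' : B} (φ : b ⟶ b') : D.fibGrpd b ≅ D.fibGrpd b' :=
  D.fibIso (D.discrete.transport φ)

theorem transportIso_heq {b b' c c' : B} (hb : b = c) (hb' : b' = c') {φ : b ⟶ b'} {χ : c ⟶ c'}
    (h : φ ≍ χ) : D.transportIso φ ≍ D.transportIso χ := by
  subst hb hb'
  rw [eq_of_heq h]

theorem transportIso_point {b b' : B} (φ : b ⟶ b') {x : D.functor.Fiber b}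
    {y : D.functor.Fiber b'} (ψ : x.1 ⟶ y.1) (h : D.functor.IsHomLift φ ψ) :
    (D.transportIso φ).hom.obj (D.point x) = D.point y :=
  (D.fibIso_point _ x).trans (congrArg D.point (D.discrete.transportFun_eq φ ψ h))

theorem transportIso_id (b : B) : D.transportIso (𝟙 b) = Iso.refl _ :=
  D.iso_ext fun x => D.transportIso_point (𝟙 b) (𝟙 x.1) (IsHomLift.id x.2)

theorem transportIso_comp {b b' b'' : B} (φ : b ⟶ b') (φ' : b' ⟶ b'') :
    D.transportIso (φ ≫ φ') = D.transportIso φ ≪≫ D.transportIso φ' := by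
  refine D.iso_ext fun x => ?_
  obtain ⟨ψ, h⟩ := D.discrete.exists_transportFun φ x
  obtain ⟨ψ', h'⟩ := D.discrete.exists_transportFun φ' (D.discrete.transportFun φ x)
  refine (D.transportIso_point (φ ≫ φ') (ψ ≫ ψ') inferInstance).trans ?_
  refine (D.transportIso_point φ' ψ' h').symm.trans ?_
  exact congrArg (D.transportIso φ').hom.obj (D.transportIso_point φ ψ h).symm

theorem isHomLift_invol {b b' : B} (φ : b ⟶ b') {a a' : A} (ψ : a ⟶ a')
    (h : D.functor.IsHomLift φ ψ) :
    D.functor.IsHomLift (D.involB.map φ) (D.involA.map ψ) := by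
  obtain ⟨⟩ := h
  exact isHomLift_of_comp_eq D.involA_functor ψ

/-- The involution of `A` carries lifts of `φ` to lifts of its conjugate. This is the commutativity
condition required of a morphism of `UObj`. -/
theorem transportIso_comm {b b' : B} (φ : b ⟶ b') :
    (D.transportIso φ).hom ≫ (D.fibIso (D.involEquiv (b := b') rfl)).hom =
      (D.fibIso (D.involEquiv (b := b) rfl)).hom ≫ (D.transportIso (D.involB.map φ)).hom := by
  refine congrArg Iso.hom (D.iso_ext (i := D.transportIso φ ≪≫ D.fibIso (D.involEquiv rfl))
    (j := D.fibIso (D.involEquiv rfl) ≪≫ D.transportIso (D.involB.map φ)) fun x => ?_)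
  obtain ⟨ψ, h⟩ := D.discrete.exists_transportFun φ x
  refine (congrArg (D.fibIso (D.involEquiv (b := b') rfl)).hom.obj
    (D.transportIso_point φ ψ h)).trans ?_
  refine (D.fibIso_point _ _).trans ?_
  refine Eq.trans ?_ (congrArg (D.transportIso (D.involB.map φ)).hom.obj
    (D.fibIso_point (D.involEquiv (b := b) rfl) x)).symm
  exact (D.transportIso_point (D.involB.map φ) (x := D.involEquiv rfl x)
    (y := D.involEquiv rfl (D.discrete.transportFun φ x)) (D.involA.map ψ)
    (D.isHomLift_invol φ ψ h)).symm

/-- The classifying functor. -/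
noncomputable def classify : B ⥤ UObj κ where
  obj b := D.fibres (b := b) rfl
  map φ := (⟨D.transportIso φ, D.transportIso (D.involB.map φ), D.transportIso_comm φ⟩ : UHom _ _)
  map_id b := UHom.ext (D.transportIso_id b)
    ((congrArg D.transportIso (D.involB.map_id b)).trans (D.transportIso_id _))
  map_comp φ φ' := UHom.ext (D.transportIso_comp φ φ')
    ((congrArg D.transportIso (D.involB.map_comp φ φ')).trans (D.transportIso_comp _ _))

/-- Conjugating `b` exchanges the two fibres and inverts the bijection between them. The equality is
strict because the involution of `B` squares to the identity strictly. -/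
theorem invol_classify : D.involB ⋙ D.classify = D.classify ⋙ UObj.swap κ := by
  have hobj : ∀ b, D.classify.obj (D.involB.obj b) = (UObj.swap κ).obj (D.classify.obj b) :=
    fun b => (D.fibres_congr rfl (Functor.congr_obj D.involB_involB b)).trans
      (D.fibres_symm rfl (Functor.congr_obj D.involB_involB b))
  refine Functor.hext hobj fun b b' φ => UHom.hext (hobj b) (hobj b') _ _ HEq.rfl ?_
  exact D.transportIso_heq (Functor.congr_obj D.involB_involB b)
    (Functor.congr_obj D.involB_involB b') (Functor.hcongr_hom D.involB_involB φ)

/-- The lift of the classifying functor to the total groupoid. -/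
noncomputable def classifyTotal : A ⥤ PtUObj κ where
  obj a := ⟨D.classify.obj (D.functor.obj a), D.point ⟨a, rfl⟩⟩
  map {a a'} α := (⟨D.classify.map (D.functor.map α),
    D.transportIso_point (D.functor.map α) (x := ⟨a, rfl⟩) (y := ⟨a', rfl⟩) α (.map α)⟩ :
      PtUHom _ _)
  map_id a := PtUHom.ext ((congrArg D.classify.map (D.functor.map_id a)).trans
    (D.classify.map_id _))
  map_comp α α' := PtUHom.ext ((congrArg D.classify.map (D.functor.map_comp α α')).trans
    (D.classify.map_comp _ _))

theorem invol_classifyTotal :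
    D.involA ⋙ D.classifyTotal = D.classifyTotal ⋙ PtUObj.swap κ := by
  have h : D.involA ⋙ D.functor ⋙ D.classify = D.functor ⋙ D.classify ⋙ UObj.swap κ := by
    rw [← invol_classify, ← Functor.assoc, D.involA_functor, Functor.assoc]
  have hobj : ∀ a, D.classifyTotal.obj (D.involA.obj a) =
      (PtUObj.swap κ).obj (D.classifyTotal.obj a) := fun a => by
    refine PtUObj.ext_of_heq (Functor.congr_obj h a) ?_
    refine HEq.trans ?_ (heq_of_eq (D.fibIso_point (D.involEquiv rfl)
      (⟨a, rfl⟩ : D.functor.Fiber (D.functor.obj a))).symm)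
    exact D.point_heq (Functor.congr_obj D.involA_functor a) rfl
  exact Functor.hext hobj fun a a' α => PtUHom.hext (hobj a) (hobj a') _ _
    (Functor.hcongr_hom h α)

end SmallInvolutiveFibration

/-! ## The universal small discrete fibration -/

theorem PtUObj.eq_of_base_heq {κ : Cardinal.{u}} {X Y₁ Y₂ : PtUObj κ} (m₁ : X ⟶ Y₁) (m₂ : X ⟶ Y₂)
    (h : Y₁.base = Y₂.base) (h' : PtUHom.base m₁ ≍ PtUHom.base m₂) : Y₁ = Y₂ ∧ m₁ ≍ m₂ := by
  have hY : Y₁ = Y₂ := by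
    obtain ⟨Y₁, y₁⟩ := Y₁
    obtain ⟨Y₂, y₂⟩ := Y₂
    obtain rfl : Y₁ = Y₂ := h
    have h₁ : PtUHom.base m₁ = PtUHom.base m₂ := eq_of_heq h'
    have h₂ : (UHom.fst (PtUHom.base m₁)).hom.obj X.pt = y₁ := m₁.map_pt
    have h₃ : (UHom.fst (PtUHom.base m₂)).hom.obj X.pt = y₂ := m₂.map_pt
    rw [← h₂, ← h₃, h₁]
  exact ⟨hY, PtUHom.hext rfl hY _ _ h'⟩

theorem PtUObj.isDiscreteGroupoidFibration_proj (κ : Cardinal.{u}) :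
    IsDiscreteGroupoidFibration (PtUObj.proj κ) := by
  refine isDiscreteGroupoidFibration_of_exists_of_unique ?_ ?_
  · intro X b φ
    change X.base ⟶ b at φ
    let Y : PtUObj κ := ⟨b, (UHom.fst φ).hom.obj X.pt⟩
    let m : X ⟶ Y := (⟨φ, rfl⟩ : PtUHom _ _)
    have hm : (PtUObj.proj κ).IsHomLift ((PtUObj.proj κ).map m) m := .map m
    exact ⟨Y, m, hm⟩
  · intro X b φ Y₁ Y₂ m₁ m₂ h₁ h₂
    exact eq_of_base_heq m₁ m₂ ((IsHomLift.codomain_eq (PtUObj.proj κ) φ m₁).trans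
      (IsHomLift.codomain_eq (PtUObj.proj κ) φ m₂).symm)
      ((map_heq_of_isHomLift h₁).trans (map_heq_of_isHomLift h₂).symm)

theorem PtUObj.isSmallDiscreteFibration_proj (κ : Cardinal.{u}) :
    IsSmallDiscreteFibration (Cardinal.lift.{u + 1} κ) (PtUObj.proj κ) := by
  refine ⟨isDiscreteGroupoidFibration_proj κ, fun X => ?_⟩
  refine lt_of_le_of_lt (Cardinal.mk_le_of_injective (β := ULift.{u + 1} X.fst)
    (f := fun Y => ⟨cast (congrArg (fun Z : UObj κ => (Z.fst : Type u)) Y.2) Y.1.pt⟩) ?_) ?_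
  · intro Y Y' h
    refine Subtype.ext (ext_of_heq (Y.2.trans Y'.2.symm) ?_)
    have := congrArg ULift.down h
    exact (cast_heq _ _).symm.trans ((heq_of_eq this).trans (cast_heq _ _))
  · rw [Cardinal.mk_uLift, Cardinal.lift_lt]
    exact X.fst_small

/-- Both vertical functors are discrete fibrations, so only objects matter: those of `A` over `y`
correspond to the points of the model of the fibre at `y`. -/
theorem SmallInvolutiveFibration.isPullback_classify {κ : Cardinal.{u}} {A B : Grpd.{u + 1, u + 1}}
    (D : SmallInvolutiveFibration κ A B) :
    IsPullback (C := Grpd.{u + 1, u + 1}) (P := A) (X := Grpd.of (PtUObj κ)) (Y := B)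
      (Z := Grpd.of (UObj κ)) D.classifyTotal D.functor (PtUObj.proj κ) D.classify := by
  refine Grpd.isPullback_of_isDiscreteGroupoidFibration (A' := A) (B' := B)
    (A := Grpd.of (PtUObj κ)) (B := Grpd.of (UObj κ)) rfl
    (PtUObj.isDiscreteGroupoidFibration_proj κ) D.discrete ?_ ?_
  · intro x y h h'
    have : ∀ {X Y : PtUObj κ}, X = Y → X.pt ≍ Y.pt := by
      rintro X _ rfl
      rfl
    exact D.eq_of_point_heq (x := ⟨x, rfl⟩) (x' := ⟨y, rfl⟩) h (this h')
  · rintro y ⟨X, z⟩ h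
    obtain rfl : X = D.classify.obj y := h
    obtain ⟨x, rfl⟩ := D.point_surjective z
    refine ⟨x.1, x.2, PtUObj.ext_of_heq (congrArg D.classify.obj x.2) (D.point_heq x.2 rfl)⟩

end Classifying

/-! ## The theorem -/

section Main

open SingleObj

namespace GpdZ2

/-- The involution of a groupoid with an involution. -/
abbrev invol (X : GpdZ2.{w}) : X.underlying ⥤ X.underlying :=
  actFunctor X (Multiplicative.ofAdd 1)

theorem invol_invol (X : GpdZ2.{w}) : X.invol ⋙ X.invol = 𝟭 X.underlying := by
  rw [← actFunctor_one, ← show Multiplicative.ofAdd (1 : ZMod 2) * Multiplicative.ofAdd 1 = 1 by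
    decide, actFunctor_mul]

/-- A morphism to a groupoid with an explicit involution. -/
def homToOfInvolution {X : GpdZ2.{w}} {H : Grpd.{w, w}} {η : H ⥤ H} {hη : η ⋙ η = 𝟭 H}
    (F : X.underlying ⥤ H) (hF : X.invol ⋙ F = F ⋙ η) : X ⟶ ofInvolution H η hη :=
  SingleObj.natTransMk (F' := ofInvolution H η hη) F fun s => by
    change Multiplicative (ZMod 2) at s
    change actFunctor X s ⋙ F = F ⋙ act η s
    by_cases hs : s = 1
    · subst hs
      rw [act, if_pos rfl, actFunctor_one]
      rfl
    · obtain rfl := eq_ofAdd_one hs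
      rw [act, if_neg hs]
      exact hF

theorem projectiveFibrations_of_isPullback {A' A B' B : GpdZ2.{w}} {t : A' ⟶ A} {g' : A' ⟶ B'}
    {g : A ⟶ B} {b : B' ⟶ B} (h : IsPullback t g' g b) (hg : projectiveFibrations g) :
    projectiveFibrations g' :=
  Grpd.isGroupoidFibration_of_isPullback (h.app (SingleObj.star _)) hg

theorem projectiveFibrations_of_isTerminal {X T : GpdZ2.{w}} (f : X ⟶ T) (hT : IsTerminal T) :
    projectiveFibrations f :=
  Grpd.isGroupoidFibration_of_isTerminal
    (hT.isTerminalObj ((evaluation _ _).obj (SingleObj.star _))) (underlyingMap f)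

/-- A single construction serves both the existence of dependent products and the smallness of their
values. -/
theorem exists_isUniversalSection {X A B : GpdZ2.{w}} (g : A ⟶ B) (f : X ⟶ A)
    (hg : projectiveFibrations g) :
    ∃ (P W : GpdZ2.{w}) (q : P ⟶ B) (w₁ : W ⟶ P) (w₂ : W ⟶ A) (ε : W ⟶ X),
      IsUniversalSection g f q w₁ w₂ ε ∧ (projectiveFibrations f → projectiveFibrations q) ∧
      ∀ c : Cardinal.{w}, c.IsInaccessible → IsSmallDiscreteFibration c (underlyingMap g) →
        IsSmallDiscreteFibration c (underlyingMap f) →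
        IsSmallDiscreteFibration c (underlyingMap q) := by
  obtain ⟨P, W, q, w₁, w₂, ε, e, he, h⟩ := exists_isUniversalSection_of_singleObj g f
    (Grpd.isUniversalSection_piEval (g := g.app (SingleObj.star _)) hg (f.app (SingleObj.star _)))
  refine ⟨P, W, q, w₁, w₂, ε, h, fun hf => ?_, fun c hc hgc hfc => ?_⟩
  · change IsGroupoidFibration (A := underlying P) (B := underlying B) (q.app (SingleObj.star _))
    rw [← he]
    exact IsGroupoidFibration.comp (A := underlying P) (C := underlying B)
      (Grpd.isDiscreteGroupoidFibration_of_isIso e.hom).1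
      (PiObj.isGroupoidFibration_proj (hg := hg) hf)
  · change IsSmallDiscreteFibration c (A := underlying P) (B := underlying B)
      (q.app (SingleObj.star _))
    rw [← he]
    exact IsSmallDiscreteFibration.comp (A := underlying P) (C := underlying B) hc.isRegular
      (Grpd.isSmallDiscreteFibration_of_isIso (by simpa using hc.nat_lt 1) e.hom)
      (PiObj.isSmallDiscreteFibration_proj (hg := hg) hc hgc hfc)

theorem isTypeTheoreticFibrationCategory :
    IsTypeTheoreticFibrationCategory projectiveFibrations.{w} where
  hasTerminal := inferInstance
  comp_mem f g hf hg := IsGroupoidFibration.comp hf hg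
  of_isIso f _ := (Grpd.isDiscreteGroupoidFibration_of_isIso (f.app (SingleObj.star _))).1
  of_isTerminal f := fun ⟨hT⟩ => projectiveFibrations_of_isTerminal f hT
  hasPullbacksAlong g _ := fun _ => inferInstance
  of_isPullback h hg := projectiveFibrations_of_isPullback h hg
  exists_dependentProduct g _ f hg hf := by
    obtain ⟨P, W, q, w₁, w₂, ε, h, hq, -⟩ := exists_isUniversalSection g f hg
    exact ⟨P, q, hq hf, h.isDependentProduct⟩
  exists_factorization f := ⟨PathObj.pathObject f, PathObj.inclusion f, PathObj.projection f,
    fun _ _ _ hp => PathObj.hasLiftingProperty_inclusion f hp,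
    PathObj.isGroupoidFibration_endpoint f, PathObj.inclusion_comp_projection f⟩

end GpdZ2

theorem Cardinal.IsInaccessible.lift {κ : Cardinal.{u}} (hκ : κ.IsInaccessible) :
    (Cardinal.lift.{v} κ).IsInaccessible := by
  refine Cardinal.isInaccessible_def.2 ⟨?_, hκ.isRegular.lift, ?_, ?_⟩
  · rw [← Cardinal.lift_aleph0.{v, u}, Cardinal.lift_lt]
    exact hκ.aleph0_lt
  · simpa using hκ.ne_zero
  · intro c hc
    obtain ⟨c, rfl⟩ := Cardinal.mem_range_lift_of_le hc.le
    rw [Cardinal.lift_lt] at hc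
    rw [← Cardinal.lift_two_power, Cardinal.lift_lt]
    exact hκ.isStrongPrelimit hc

/-- Smallness becomes a condition on underlying functors, which reduces the universe axioms to
statements about discrete fibrations and cardinals. -/
theorem isSmallFibration_universeProj_iff {κ : Cardinal.{u}} (hκ : κ.IsInaccessible)
    {A B : GpdZ2.{u + 1}} (f : A ⟶ B) : IsSmallFibration (universeProj κ) f ↔
      IsSmallDiscreteFibration (Cardinal.lift.{u + 1} κ) (GpdZ2.underlyingMap f) := by
  constructor
  · rintro ⟨t, b, h⟩
    exact Grpd.isSmallDiscreteFibration_of_isPullback hκ.isRegular.lift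
      (h.app (SingleObj.star _)) (PtUObj.isSmallDiscreteFibration_proj κ)
  · intro h
    let D : SmallInvolutiveFibration κ A.underlying B.underlying :=
      { functor := GpdZ2.underlyingMap f
        discrete := h.discrete
        card_lt := h.card_lt
        involA := A.invol
        involB := B.invol
        involA_involA := A.invol_invol
        involB_involB := B.invol_invol
        involA_functor := actFunctor_comp_appFunctor f _ }
    exact ⟨GpdZ2.homToOfInvolution (H := Grpd.of (PtUObj κ)) D.classifyTotal
      D.invol_classifyTotal, GpdZ2.homToOfInvolution (H := Grpd.of (UObj κ)) D.classify
      D.invol_classify, IsPullback.of_forall_isPullback_app fun _ => D.isPullback_classify⟩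

theorem one_lt_lift {κ : Cardinal.{u}} (hκ : κ.IsInaccessible) : 1 < Cardinal.lift.{v} κ := by
  simpa using hκ.nat_lt 1

theorem isUniverse_universeProj {κ : Cardinal.{u}} (hκ : κ.IsInaccessible) :
    IsUniverse GpdZ2.projectiveFibrations.{u + 1} (universeProj κ) where
  fib := (PtUObj.isDiscreteGroupoidFibration_proj κ).1
  id_small X := (isSmallFibration_universeProj_iff hκ _).2
    (Grpd.isSmallDiscreteFibration_of_isIso (one_lt_lift hκ)
      (𝟙 (X.obj (SingleObj.star _))))
  comp_small f g hf hg := by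
    rw [isSmallFibration_universeProj_iff hκ] at hf hg ⊢
    exact hf.comp hκ.lift.isRegular hg
  dependentProduct_small {X A B P} f g _ q hf hg hq := by
    rw [isSmallFibration_universeProj_iff hκ] at hf hg ⊢
    -- The given `q` is only known up to its universal property; it is isomorphic over `B` to the
    -- constructed product, whose fibres have been counted.
    obtain ⟨P', W, q', w₁, w₂, ε, h, -, hq'⟩ := GpdZ2.exists_isUniversalSection g f hg.discrete.1
    obtain ⟨e, rfl⟩ := hq.exists_iso h.isDependentProduct
    exact IsSmallDiscreteFibration.comp (A := GpdZ2.underlying P)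
      (C := GpdZ2.underlying B) hκ.lift.isRegular
      (Grpd.isSmallDiscreteFibration_of_isIso (one_lt_lift hκ)
        (e.hom.app (SingleObj.star _))) (hq' _ hκ.lift hg hf)
  exists_factorization {A B X} a b f ha hb hf := by
    subst hf
    -- No path object is needed: `f` is already small, and an identity lifts against everything.
    refine ⟨A, 𝟙 A, f, fun _ _ _ _ => inferInstance, ?_, Category.id_comp f⟩
    rw [isSmallFibration_universeProj_iff hκ] at ha hb ⊢
    exact IsSmallDiscreteFibration.of_comp ha hb.discrete

theorem mainTheorem2 (κ : Cardinal.{u}) (hκ : κ.IsInaccessible) :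
    IsTypeTheoreticFibrationCategory GpdZ2.projectiveFibrations.{u + 1} ∧
    IsUniverse GpdZ2.projectiveFibrations.{u + 1} (universeProj κ) ∧
    ∀ {A B : GpdZ2.{u + 1}} (f : A ⟶ B), IsSmallFibration (universeProj κ) f ↔
      IsDiscreteGroupoidFibration (GpdZ2.underlyingMap f) ∧
        ∀ b : B.underlying, #((GpdZ2.underlyingMap f).Fiber b) < Cardinal.lift.{u + 1} κ :=
  ⟨GpdZ2.isTypeTheoreticFibrationCategory, isUniverse_universeProj hκ, fun f =>
    (isSmallFibration_universeProj_iff hκ f).trans ⟨fun h => ⟨h.discrete, h.card_lt⟩,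
      fun h => ⟨h.1, h.2⟩⟩⟩

end Main
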